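/- **Conventions.** Let $-\infty<a<b<\infty$, $d\in\mathbb N$, and let $E=\mathbb R^d$ or $E=\mathbb R$ with the Euclidean norm. A function $u\in L^1(]a,b[;E)$ is in $BV(]a,b[;E)$ if $$TV(u):=\sup\Big\{\int_a^b u\cdot\varphi'\,dx:\ \varphi\in C^1_c(]a,b[;E),\ \|\varphi\|_\infty\le 1\Big\}<\infty .$$ Then its distributional derivative $Du$ is a finite ($E$-valued) Borel measure on $]a,b[$. Further, $u(x_\pm)$ denote the one-sided limits $\lim_{\varepsilon\to0^+}\frac1\varepsilon\int_x^{x+\varepsilon}u$ and $\lim_{\varepsilon\to0^+}\frac1\varepsilon\int_{x-\varepsilon}^{x}u$ (in the right and left case respectively), $J_u=\{x: u(x_-)\ne u(x_+)\}$ is the jump set, $\nabla u$ is the density of the absolutely continuous part of $Du$ with respect to Lebesgue measure, and the Cantor part $D^cu$ is the restriction to $]a,b[\setminus J_u$ of the singular part of $Du$. The function $u$ is a *good representative* if its pointwise variation $\sup\sum_i|u(t_{i+1})-u(t_i)|$ over $a<t_1<\dots<t_n<b$ equals $TV(u)$. A *Cantor measure* is a nonnegative Borel measure without atoms and orthogonal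 to Lebesgue measure. **Theorem 4.1.** Let $B:\,]a,b[\times\mathbb R^d\to\mathbb R$ be locally bounded and such that: * (A1) for every $w\in\mathbb R^d$ the function $B(\cdot,w)$ is a good representative of a function of $BV(]a,b[)$, and there is a countable set $\mathcal N\subset\,]a,b[$ with $J_{B(\cdot,w)}\subseteq\mathcal N$ for every $w$; * (A2) for every compact $M\subset\mathbb R^d$ there is a finite positive Borel measure $\mu_M$ on $]a,b[$ such that $|D_xB(\cdot,w)-D_xB(\cdot,w')|(A)\le|w-w'|\,\mu_M(A)$ for all $w,w'\in M$ and all Borel $A\subseteq\,]a,b[$, where $|\cdot|$ on the left is the total variation measure; * (A3) for every $x\in\,]a,b[\setminus\mathcal N$ the function $B(x,\cdot)$ is in $C^1(\mathbb R^d)$, and for every compact $M\subset\mathbb R^d$ there is $D_M>0$ with $|D_wB(x,w)|\le D_M$ for all $x\in\,]a,b[\setminus\mathcal N$, $w\in M$; * (A4) $D_wB(\cdot,w)$ (defined off the null set $\mathcal N$) belongs to $BV(]a,b[;\mathbb R^d)$ for every $w\in\mathbb R^d$; * (A5) there is a finite Cantor measure $\lambda$ on $]a,b[$ such that $D^c_xB(\cdot,w)\ll\lambda$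 for every $w\in\mathbb R^d$. Then there are functions $\nabla_xB,\psi:\,]a,b[\times\mathbb R^d\to\mathbb R$ such that, for every $w$, $\nabla_xB(\cdot,w)$ is the density of the absolutely continuous part of $D_xB(\cdot,w)$ with respect to Lebesgue measure and $\psi(\cdot,w)$ is the Radon–Nikodým derivative $\frac{d\,D^c_xB(\cdot,w)}{d\lambda}$, and such that $\nabla_xB(x,\cdot)$ is continuous for Lebesgue-a.e. $x$ and $\psi(x,\cdot)$ is continuous for $\lambda$-a.e. $x$. Moreover, for every (good representative) $u\in BV(]a,b[;\mathbb R^d)$, the composite function $v(x):=B(x,u(x))$ belongs to $BV(]a,b[)$, and for any such $\nabla_xB$ and $\psi$ the following holds: $\nabla_xB(\cdot,u(\cdot))\in L^1(]a,b[)$, $\psi(\cdot,u(\cdot))\in L^1(\lambda)$, for $i=1,\dots,d$ the functions $\partial_{w^i}B(\cdot,u(\cdot))\nabla u^i$ and $\partial_{w^i}B(\cdot,u(\cdot))$ are integrable with respect to $dx$ and $|D^cu^i|$ respectively, the series $\sum_{x\in\mathcal N\cup J_u}|B(x_+,u(x_+))-B(x_-,u(x_-))|$ converges, and for every $\phi\in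 C^1_c(]a,b[)$ $$\begin{aligned}\int_{]a,b[}\phi'(x)\,v(x)\,dx={}&-\int_{]a,b[}\phi(x)\,(\nabla_xB)(x,u(x))\,dx-\int_{]a,b[}\phi(x)\,\psi(x,u(x))\,d\lambda\\&-\int_{]a,b[}\phi(x)\,(D_wB)(x,u(x))\cdot\nabla u(x)\,dx-\int_{]a,b[}\phi(x)\,(D_wB)(x,u(x))\cdot dD^cu(x)\\&-\sum_{x\in\mathcal N\cup J_u}\phi(x)\,\big[B(x_+,u(x_+))-B(x_-,u(x_-))\big],\end{aligned}$$ where $B(x_\pm,w)$ are the one-sided limits at $x$ of $B(\cdot,w)$. -/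

import Mathlib

open MeasureTheory Set Filter Topology
open scoped ENNReal

namespace BVChain

noncomputable section

/-- Test functions of class `C¹` with compact support in the open interval `]a, b[`. -/
structure IsTestFun {E : Type*} [NormedAddCommGroup E] [NormedSpace ℝ E] (a b : ℝ)
    (φ : ℝ → E) : Prop where
  contDiff : ContDiff ℝ 1 φ
  hasCompactSupport : HasCompactSupport φ
  tsupport_subset : tsupport φ ⊆ Ioo a b

/-- The (distributional) total variation of `u` on `]a, b[`: the supremum of `∫ u · φ'` over the
test fields `φ` with `‖φ‖_∞ ≤ 1`. For a scalar `u`, the inner product is the product. -/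
def totalVar {E : Type*} [NormedAddCommGroup E] [InnerProductSpace ℝ E] (a b : ℝ)
    (u : ℝ → E) : ℝ≥0∞ :=
  ⨆ φ : {φ : ℝ → E // IsTestFun a b φ ∧ ∀ x, ‖φ x‖ ≤ 1},
    ENNReal.ofReal (∫ x in Ioo a b, inner ℝ (u x) (deriv φ.1 x))

/-- `u` (more precisely its a.e. class) belongs to `BV(]a, b[; E)`. -/
def IsBV {E : Type*} [NormedAddCommGroup E] [InnerProductSpace ℝ E] (a b : ℝ)
    (u : ℝ → E) : Prop :=
  IntegrableOn u (Ioo a b) ∧ totalVar a b u < ∞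

/-- `u` is a good representative of a `BV` function: its pointwise variation on `]a, b[` equals
the total variation of its a.e. class. -/
def IsGoodBV {E : Type*} [NormedAddCommGroup E] [InnerProductSpace ℝ E] (a b : ℝ)
    (u : ℝ → E) : Prop :=
  IsBV a b u ∧ eVariationOn u (Ioo a b) = totalVar a b u

/-- The left limit `u(x₋)`, as the limit of averages. -/
def leftTrace {E : Type*} [NormedAddCommGroup E] [NormedSpace ℝ E] (u : ℝ → E) (x : ℝ) : E :=
  limUnder (𝓝[>] (0 : ℝ)) (fun ε => ε⁻¹ • ∫ y in (x - ε)..x, u y)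

/-- The right limit `u(x₊)`, as the limit of averages. -/
def rightTrace {E : Type*} [NormedAddCommGroup E] [NormedSpace ℝ E] (u : ℝ → E) (x : ℝ) : E :=
  limUnder (𝓝[>] (0 : ℝ)) (fun ε => ε⁻¹ • ∫ y in x..(x + ε), u y)

/-- The jump set `J_u`. -/
def jumpSet {E : Type*} [NormedAddCommGroup E] [NormedSpace ℝ E] (a b : ℝ) (u : ℝ → E) : Set ℝ :=
  {x | x ∈ Ioo a b ∧ leftTrace u x ≠ rightTrace u x}

/-- The finite signed Borel measure `μ`, carried by `]a, b[`, is the distributional derivative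
of `f` on `]a, b[`. -/
def IsDistribDeriv (a b : ℝ) (f : ℝ → ℝ) (μ : SignedMeasure ℝ) : Prop :=
  (∀ A : Set ℝ, MeasurableSet A → Disjoint A (Ioo a b) → μ A = 0) ∧
  ∀ φ : ℝ → ℝ, IsTestFun a b φ →
    ∫ x in Ioo a b, deriv φ x * f x = - VectorMeasure.integral μ φ (ContinuousLinearMap.lsmul ℝ ℝ)

open scoped Classical in
/-- The distributional derivative `Df` of a scalar `BV` function on `]a, b[`, as a signed measure
on `ℝ` carried by `]a, b[` (and `0` if `Df` is not a finite measure). -/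
def distribDeriv (a b : ℝ) (f : ℝ → ℝ) : SignedMeasure ℝ :=
  if h : ∃ μ : SignedMeasure ℝ, IsDistribDeriv a b f μ then h.choose else 0

/-- The density `∇f` of the absolutely continuous part of `Df` with respect to Lebesgue measure
(defined up to null sets). -/
def nabla (a b : ℝ) (f : ℝ → ℝ) : ℝ → ℝ :=
  (distribDeriv a b f).rnDeriv volume

/-- The Cantor part `Dᶜf`: the singular part of `Df`, off the jump set. -/
def cantorPart (a b : ℝ) (f : ℝ → ℝ) : SignedMeasure ℝ :=
  ((distribDeriv a b f).singularPart volume).restrict (Ioo a b \ jumpSet a b f)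

/-- A finite Cantor measure on `]a, b[`: a finite nonnegative Borel measure without atoms,
orthogonal to Lebesgue measure. -/
structure IsCantorMeasure (a b : ℝ) (lam : Measure ℝ) : Prop where
  finite : IsFiniteMeasure lam
  carried : lam (Ioo a b)ᶜ = 0
  diffuse : ∀ x, lam {x} = 0
  singular : lam ⟂ₘ volume

/-- `g(·, w)` is, for each parameter `w`, the Radon–Nikodým derivative with respect to `m` of the
measure `ν w`, where the versions are chosen so that `g(x, ·)` is continuous for `m`-a.e. `x`.
(Without such a choice, `g(x, u(x))` would not be determined `m`-a.e. by the measures `ν w`.) -/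
def IsDensityFamily {E : Type*} [TopologicalSpace E] (m : Measure ℝ) (ν : E → SignedMeasure ℝ)
    (g : ℝ → E → ℝ) : Prop :=
  (∀ w, (fun x => g x w) =ᵐ[m] (ν w).rnDeriv m) ∧ ∀ᵐ x ∂m, Continuous (g x)

/-- `B(x₊, u(x₊)) - B(x₋, u(x₋))`, where `B(x₊, w)` and `B(x₋, w)` are the one-sided limits of
`B(·, w)` at `x`. -/
def compJump {E : Type*} [NormedAddCommGroup E] [NormedSpace ℝ E] (B : ℝ → E → ℝ) (u : ℝ → E)
    (x : ℝ) : ℝ :=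
  rightTrace (fun y => B y (rightTrace u x)) x - leftTrace (fun y => B y (leftTrace u x)) x

end

end BVChain

/-!
# The chain rule for `x ↦ B(x, u(x))` with `B(·, w)` and `u` of bounded variation

All the derivatives `Dₓ B(·, w)` are absolutely continuous with respect to one finite measure
`m = dx + lam + ζ`, where `ζ` has its atoms at the points of `N`. Since the densities depend on `w` in
a locally Lipschitz way, they have a version `ρ(x, w)` which is continuous in `w`
(`exists_density_family`). By uniqueness of the Lebesgue decomposition, `ρ` serves both as `∇ₓ B` and
as the density `ψ` of the Cantor part (`rnDeriv_restrict_ae_eq`, `cantorPart_eq_withDensity`), and any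
other admissible choice agrees with it at almost every `x` for all `w` at once. In the same way
`Du = θ κ`, with a measure `κ` of the same form.

Off a countable set, the complement of a regular set `T` (`exists_isRegularSet`), `u` is continuous,
all the `B(·, w)` are continuous and the gradient `D_w B` is jointly continuous along `T`. The
heart of the proof is the formula for increments between two points of `T`
(`IsRegularSet.comp_sub_comp`): along partitions by points of `T`, each increment
`B(t', u(t')) - B(t, u(t))` is split into `B(t', u(t')) - B(t, u(t'))`, which is the integral of
`ρ(·, u(t'))` over `]t, t']`, and `B(t, u(t')) - B(t, u(t))`, which by the mean value theorem is the
integral of `⟪D_w B(t, ξ), θ⟫`. As the mesh tends to zero, both sums converge by dominated convergence;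
at an atom `s` of `κ` the second one gives `B(s₋, u(s₊)) - B(s₋, u(s₋))`, and the first one gives
`B(s₊, u(s₊)) - B(s₋, u(s₊))`, so that together they give the jump of the composition.

Hence the derivative of the composition is `ρ(·, u) m + L κ` with an explicit density `L`
(`innerDensity`). Integrating by parts with Fubini's theorem
(`IsTestFun.setIntegral_deriv_mul_of_increments`) and separating the regular set, where `m` and `κ`
are diffuse, from its countable complement gives the formula.
-/

namespace BVChain

/-! ### Functions of bounded variation on an open interval -/

section BoundedVariation

variable {F : Type*} [NormedAddCommGroup F] {a b : ℝ} {f : ℝ → F}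

lemma exists_tendsto_nhdsGT [CompleteSpace F] (hf : BoundedVariationOn f (Ioo a b)) {x : ℝ}
    (hx : x ∈ Ico a b) : ∃ l, Tendsto f (𝓝[>] x) (𝓝 l) := by
  obtain ⟨l, hl⟩ := hf.exists_tendsto_right x
  refine ⟨l, hl.mono_left ?_⟩
  have h : Ioo a b ∩ Ioi x ∈ 𝓝[>] x := by
    filter_upwards [Ioo_mem_nhdsGT hx.2] with y hy using ⟨⟨hx.1.trans_lt hy.1, hy.2⟩, hy.1⟩
  exact nhdsWithin_le_of_mem h

lemma exists_tendsto_nhdsLT [CompleteSpace F] (hf : BoundedVariationOn f (Ioo a b)) {x : ℝ}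
    (hx : x ∈ Ioc a b) : ∃ l, Tendsto f (𝓝[<] x) (𝓝 l) := by
  obtain ⟨l, hl⟩ := hf.exists_tendsto_left x
  refine ⟨l, hl.mono_left ?_⟩
  have h : Ioo a b ∩ Iio x ∈ 𝓝[<] x := by
    filter_upwards [Ioo_mem_nhdsLT hx.1] with y hy using ⟨⟨hy.1, hy.2.trans_le hx.2⟩, hy.2⟩
  exact nhdsWithin_le_of_mem h

/-- A function of bounded variation on `]a, b[` extends to one on the line: it is prolonged by its
limits at the end points, and is then a pointwise limit of the functions `f ∘ π` with `π` the
projection on a compact subinterval. -/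
lemma exists_boundedVariationOn_univ [CompleteSpace F] (hab : a < b)
    (hf : BoundedVariationOn f (Ioo a b)) :
    ∃ g : ℝ → F, BoundedVariationOn g univ ∧ EqOn g f (Ioo a b) := by
  obtain ⟨la, hla⟩ := exists_tendsto_nhdsGT hf (x := a) ⟨le_rfl, hab⟩
  obtain ⟨lb, hlb⟩ := exists_tendsto_nhdsLT hf (x := b) ⟨hab, le_rfl⟩
  let g : ℝ → F := fun x => if x ≤ a then la else if b ≤ x then lb else f x
  let δ : ℕ → ℝ := fun n => (b - a) / 2 * (1 / ((n : ℝ) + 1))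
  have hba : 0 < (b - a) / 2 := by linarith
  have hδ0 : ∀ n, 0 < δ n := fun n => by positivity
  have hδ1 : ∀ n, δ n ≤ (b - a) / 2 := fun n => by
    have : 1 / ((n : ℝ) + 1) ≤ 1 := by
      rw [div_le_one (by positivity)]
      linarith [(Nat.cast_nonneg n : (0 : ℝ) ≤ n)]
    exact mul_le_of_le_one_right hba.le this
  have hδ : Tendsto δ atTop (𝓝 0) := by
    have := (tendsto_one_div_add_atTop_nhds_zero_nat (𝕜 := ℝ)).const_mul ((b - a) / 2)
    rwa [mul_zero] at this
  let p : ℕ → ℝ → ℝ := fun n x => max (a + δ n) (min x (b - δ n))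
  have hp : ∀ n x, p n x ∈ Ioo a b := fun n x => by
    have := hδ0 n
    have := hδ1 n
    refine ⟨lt_of_lt_of_le (by linarith) (le_max_left _ _), max_lt (by linarith) ?_⟩
    exact (min_le_right _ _).trans_lt (by linarith)
  have hpm : ∀ n, Monotone (p n) := fun n x y hxy => by
    simp only [p]; gcongr
  have hlim : ∀ x ∈ (univ : Set ℝ), Tendsto (fun n => (f ∘ p n) x) atTop (𝓝 (g x)) := by
    intro x _
    by_cases hxa : x ≤ a
    · have h1 : ∀ n, p n x = a + δ n := fun n => by
        have := hδ0 n
        exact max_eq_left ((min_le_left _ _).trans (by linarith))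
      simp only [Function.comp_def, h1, g, hxa, if_true]
      refine hla.comp (tendsto_nhdsWithin_iff.2 ⟨by simpa using hδ.const_add a, ?_⟩)
      exact Eventually.of_forall fun n => by simpa using hδ0 n
    · by_cases hxb : b ≤ x
      · have h1 : ∀ n, p n x = b - δ n := fun n => by
          have := hδ0 n
          have := hδ1 n
          simp only [p]
          rw [min_eq_right (by linarith), max_eq_right (by linarith)]
        simp only [Function.comp_def, h1, g, hxa, hxb, if_true, if_false]
        refine hlb.comp (tendsto_nhdsWithin_iff.2 ⟨by simpa using hδ.const_sub b, ?_⟩)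
        exact Eventually.of_forall fun n => by simpa using hδ0 n
      · push Not at hxa hxb
        have h1 : ∀ᶠ n in atTop, p n x = x := by
          filter_upwards [hδ.eventually (gt_mem_nhds (sub_pos.2 hxa)),
            hδ.eventually (gt_mem_nhds (sub_pos.2 hxb))] with n h1 h2
          simp only [p]
          rw [min_eq_left (by linarith), max_eq_right (by linarith)]
        simp only [g, not_le.2 hxa, not_le.2 hxb, if_false]
        exact tendsto_const_nhds.congr' (h1.mono fun n hn => by simp [hn])
  refine ⟨g, ?_, fun x hx => by simp [g, not_le.2 hx.1, not_le.2 hx.2]⟩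
  refine ne_top_of_le_ne_top hf (le_of_not_gt fun h => ?_)
  obtain ⟨n, hn⟩ := (eVariationOn.lowerSemicontinuous_aux hlim h).exists
  exact not_lt.2 (eVariationOn.comp_le_of_monotoneOn f (p n) ((hpm n).monotoneOn _)
    fun x _ => hp n x) hn

lemma countable_not_continuousAt [CompleteSpace F] (hab : a < b)
    (hf : BoundedVariationOn f (Ioo a b)) : {x ∈ Ioo a b | ¬ ContinuousAt f x}.Countable := by
  obtain ⟨g, hg, hgf⟩ := exists_boundedVariationOn_univ hab hf
  have hV : Monotone (variationOnFromTo g univ 0) :=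
    monotoneOn_univ.1 (variationOnFromTo.monotoneOn hg.locallyBoundedVariationOn (mem_univ _))
  refine hV.countable_not_continuousAt.mono fun x hx => mt (fun hc => ?_) hx.2
  have key : ∀ x y, dist (g x) (g y) ≤
      |variationOnFromTo g univ 0 x - variationOnFromTo g univ 0 y| := by
    have : ∀ x y, x ≤ y → dist (g x) (g y) ≤
        |variationOnFromTo g univ 0 y - variationOnFromTo g univ 0 x| := by
      intro x y hxy
      rw [← variationOnFromTo.add hg.locallyBoundedVariationOn (mem_univ 0) (mem_univ x)
        (mem_univ y), add_sub_cancel_left, variationOnFromTo.eq_of_le _ _ hxy]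
      refine le_trans ?_ (le_abs_self _)
      exact (hg.mono (subset_univ _)).dist_le ⟨mem_univ _, le_rfl, hxy⟩ ⟨mem_univ _, hxy, le_rfl⟩
    intro x y
    rcases le_total x y with h | h
    · rw [abs_sub_comm]; exact this x y h
    · rw [dist_comm]; exact this y x h
  have hgc : ContinuousAt g x := by
    rw [ContinuousAt, tendsto_iff_dist_tendsto_zero] at hc ⊢
    exact squeeze_zero (fun _ => dist_nonneg) (fun y => key y x) hc
  exact hgc.congr (hgf.eventuallyEq_of_mem (Ioo_mem_nhds hx.1.1 hx.1.2))

end BoundedVariation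

section Traces

variable {F : Type*} [NormedAddCommGroup F] [NormedSpace ℝ F] [CompleteSpace F] {a b : ℝ}
  {f : ℝ → F}

lemma rightTrace_eq_of_tendsto {l : F} {x : ℝ} (hf : IntegrableOn f (Ioo a b)) (hx : x ∈ Ioo a b)
    (h : Tendsto f (𝓝[>] x) (𝓝 l)) : rightTrace f x = l := by
  refine Tendsto.limUnder_eq ?_
  have hmeas : StronglyMeasurableAtFilter f (𝓝[>] x) volume :=
    ⟨Ioo a b, mem_nhdsWithin_of_mem_nhds (Ioo_mem_nhds hx.1 hx.2), hf.aestronglyMeasurable⟩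
  have hd := intervalIntegral.integral_hasDerivWithinAt_of_tendsto_ae_right
    (f := f) (a := x) (b := x) (s := Ici x) (t := Ioi x) (by simp) hmeas (h.mono_left inf_le_left)
  have := (hasDerivWithinAt_iff_tendsto_slope' (notMem_Ioi.2 le_rfl)).1
    (hd.mono Ioi_subset_Ici_self)
  have hshift : Tendsto (fun ε : ℝ => x + ε) (𝓝[>] 0) (𝓝[>] x) := by
    refine tendsto_nhdsWithin_iff.2 ⟨?_, ?_⟩
    · have : Tendsto (fun ε : ℝ => x + ε) (𝓝 0) (𝓝 (x + 0)) := tendsto_id.const_add x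
      simpa using this.mono_left nhdsWithin_le_nhds
    · filter_upwards [self_mem_nhdsWithin] with ε hε
      simpa using hε
  refine (this.comp hshift).congr fun ε => ?_
  simp [slope]

lemma leftTrace_eq_of_tendsto {l : F} {x : ℝ} (hf : IntegrableOn f (Ioo a b)) (hx : x ∈ Ioo a b)
    (h : Tendsto f (𝓝[<] x) (𝓝 l)) : leftTrace f x = l := by
  refine Tendsto.limUnder_eq ?_
  have hmeas : StronglyMeasurableAtFilter f (𝓝[≤] x) volume :=
    ⟨Ioo a b, mem_nhdsWithin_of_mem_nhds (Ioo_mem_nhds hx.1 hx.2), hf.aestronglyMeasurable⟩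
  have hle : (𝓝[≤] x) ⊓ ae volume ≤ 𝓝[<] x := by
    refine le_inf (inf_le_left.trans nhdsWithin_le_nhds) (le_principal_iff.2 ?_)
    have h1 : ({x} : Set ℝ)ᶜ ∈ ae volume := compl_mem_ae_iff.2 (by simp)
    filter_upwards [mem_inf_of_left self_mem_nhdsWithin, mem_inf_of_right h1] with y hy hy'
    exact lt_of_le_of_ne hy hy'
  have hd := intervalIntegral.integral_hasDerivWithinAt_of_tendsto_ae_right
    (f := f) (a := x) (b := x) (s := Iic x) (t := Iic x) (by simp) hmeas (h.mono_left hle)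
  have := (hasDerivWithinAt_iff_tendsto_slope' (notMem_Iio.2 le_rfl)).1
    (hd.mono Iio_subset_Iic_self)
  have hshift : Tendsto (fun ε : ℝ => x - ε) (𝓝[>] 0) (𝓝[<] x) := by
    refine tendsto_nhdsWithin_iff.2 ⟨?_, ?_⟩
    · have : Tendsto (fun ε : ℝ => x - ε) (𝓝 0) (𝓝 (x - 0)) := tendsto_id.const_sub x
      simpa using this.mono_left nhdsWithin_le_nhds
    · filter_upwards [self_mem_nhdsWithin] with ε hε
      simpa using hε
  refine (this.comp hshift).congr fun ε => ?_
  simp [slope, intervalIntegral.integral_symm x (x - ε)]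

lemma tendsto_rightTrace (hf : BoundedVariationOn f (Ioo a b)) (hi : IntegrableOn f (Ioo a b))
    {x : ℝ} (hx : x ∈ Ioo a b) : Tendsto f (𝓝[>] x) (𝓝 (rightTrace f x)) := by
  obtain ⟨l, hl⟩ := exists_tendsto_nhdsGT hf (x := x) ⟨hx.1.le, hx.2⟩
  rwa [rightTrace_eq_of_tendsto hi hx hl]

lemma tendsto_leftTrace (hf : BoundedVariationOn f (Ioo a b)) (hi : IntegrableOn f (Ioo a b))
    {x : ℝ} (hx : x ∈ Ioo a b) : Tendsto f (𝓝[<] x) (𝓝 (leftTrace f x)) := by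
  obtain ⟨l, hl⟩ := exists_tendsto_nhdsLT hf (x := x) ⟨hx.1, hx.2.le⟩
  rwa [leftTrace_eq_of_tendsto hi hx hl]

lemma rightTrace_eq_of_continuousAt (hi : IntegrableOn f (Ioo a b)) {x : ℝ} (hx : x ∈ Ioo a b)
    (hc : ContinuousAt f x) : rightTrace f x = f x :=
  rightTrace_eq_of_tendsto hi hx (hc.mono_left nhdsWithin_le_nhds)

lemma leftTrace_eq_of_continuousAt (hi : IntegrableOn f (Ioo a b)) {x : ℝ} (hx : x ∈ Ioo a b)
    (hc : ContinuousAt f x) : leftTrace f x = f x :=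
  leftTrace_eq_of_tendsto hi hx (hc.mono_left nhdsWithin_le_nhds)

/-- The derivative of a function of bounded variation, constructed as a Stieltjes measure. -/
lemma exists_stieltjes_vectorMeasure (hab : a < b) (hf : BoundedVariationOn f (Ioo a b))
    (hi : IntegrableOn f (Ioo a b)) :
    ∃ ω : VectorMeasure ℝ F, (∀ A, MeasurableSet A → Disjoint A (Ioo a b) → ω A = 0) ∧
      (∀ x ∈ Ioo a b, ∀ y ∈ Ioo a b, x ≤ y → ω (Ioc x y) = rightTrace f y - rightTrace f x) ∧
      ∀ x ∈ Ioo a b, ω {x} = rightTrace f x - leftTrace f x := by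
  obtain ⟨g, hg, hgf⟩ := exists_boundedVariationOn_univ hab hf
  have hr : ∀ x ∈ Ioo a b, g.rightLim x = rightTrace f x := fun x hx =>
    tendsto_nhds_unique (hg.tendsto_rightLim x) ((tendsto_rightTrace hf hi hx).congr'
      (hgf.symm.eventuallyEq_of_mem (mem_nhdsWithin_of_mem_nhds (Ioo_mem_nhds hx.1 hx.2))))
  have hl : ∀ x ∈ Ioo a b, g.leftLim x = leftTrace f x := fun x hx =>
    tendsto_nhds_unique (hg.tendsto_leftLim x) ((tendsto_leftTrace hf hi hx).congr'
      (hgf.symm.eventuallyEq_of_mem (mem_nhdsWithin_of_mem_nhds (Ioo_mem_nhds hx.1 hx.2))))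
  refine ⟨hg.vectorMeasure.restrict (Ioo a b), fun A hA hd => ?_, fun x hx y hy hxy => ?_,
    fun x hx => ?_⟩
  · rw [VectorMeasure.restrict_apply _ measurableSet_Ioo hA, hd.inter_eq, VectorMeasure.empty]
  · rw [VectorMeasure.restrict_eq_self _ measurableSet_Ioo measurableSet_Ioc
      (fun z hz => ⟨hx.1.trans hz.1, hz.2.trans_lt hy.2⟩), hg.vectorMeasure_Ioc hxy, hr x hx,
      hr y hy]
  · rw [VectorMeasure.restrict_eq_self _ measurableSet_Ioo (measurableSet_singleton x)
      (by simpa using hx), hg.vectorMeasure_singleton, hr x hx, hl x hx]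

end Traces

/-! ### Test functions and integration by parts -/

section TestFunctions

variable {a b : ℝ} {φ : ℝ → ℝ}

lemma IsTestFun.deriv_eq_zero (hφ : IsTestFun a b φ) {x : ℝ} (hx : x ∉ Ioo a b) :
    deriv φ x = 0 := by
  by_contra h
  exact hx (hφ.tsupport_subset (support_deriv_subset h))

lemma IsTestFun.continuous_deriv (hφ : IsTestFun a b φ) : Continuous (deriv φ) :=
  hφ.contDiff.continuous_deriv le_rfl

lemma IsTestFun.integrable_deriv (hφ : IsTestFun a b φ) : Integrable (deriv φ) :=
  hφ.continuous_deriv.integrable_of_hasCompactSupport hφ.hasCompactSupport.deriv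

lemma IsTestFun.exists_bound (hφ : IsTestFun a b φ) : ∃ C, ∀ x, ‖φ x‖ ≤ C :=
  hφ.hasCompactSupport.exists_bound_of_continuous hφ.contDiff.continuous

lemma IsTestFun.integrable_mul (hφ : IsTestFun a b φ) {m : Measure ℝ} {h : ℝ → ℝ}
    (hh : Integrable h m) : Integrable (fun x => φ x * h x) m := by
  obtain ⟨C, hC⟩ := hφ.exists_bound
  exact hh.bdd_mul hφ.contDiff.continuous.aestronglyMeasurable (Eventually.of_forall hC)

lemma IsTestFun.integral_deriv (hφ : IsTestFun a b φ) : ∫ x, deriv φ x = 0 := by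
  have h := integral_add_compl (measurableSet_Iic (a := (0 : ℝ))) hφ.integrable_deriv
  rw [hφ.hasCompactSupport.integral_Iic_deriv_eq hφ.contDiff, compl_Iic,
    hφ.hasCompactSupport.integral_Ioi_deriv_eq hφ.contDiff] at h
  rw [← h, add_neg_cancel]

lemma IsTestFun.setIntegral_deriv_mul (hφ : IsTestFun a b φ) (f : ℝ → ℝ) :
    ∫ x in Ioo a b, deriv φ x * f x = ∫ x, deriv φ x * f x :=
  setIntegral_eq_integral_of_forall_compl_eq_zero fun x hx => by simp [hφ.deriv_eq_zero hx]

/-- Integration by parts against the distribution function of `h • m`, by Fubini's theorem. -/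
lemma IsTestFun.integral_deriv_mul_setIntegral_Iic (hφ : IsTestFun a b φ) (m : Measure ℝ)
    [IsFiniteMeasure m] {h : ℝ → ℝ} (hh : Integrable h m) :
    Integrable (fun x => deriv φ x * ∫ s in Iic x, h s ∂m) ∧
      ∫ x, deriv φ x * ∫ s in Iic x, h s ∂m = -∫ x, φ x * h x ∂m := by
  have hS : MeasurableSet {p : ℝ × ℝ | p.2 ≤ p.1} := measurableSet_le measurable_snd measurable_fst
  have hI : Integrable ({p : ℝ × ℝ | p.2 ≤ p.1}.indicator fun p => deriv φ p.1 * h p.2)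
      (volume.prod m) := (hφ.integrable_deriv.mul_prod hh).indicator hS
  have h1 : ∀ x, ∫ s, ({p : ℝ × ℝ | p.2 ≤ p.1}.indicator fun p => deriv φ p.1 * h p.2) (x, s) ∂m
      = deriv φ x * ∫ s in Iic x, h s ∂m := fun x => by
    rw [← integral_const_mul, ← integral_indicator measurableSet_Iic]
    rfl
  have h2 : ∀ s, ∫ x, ({p : ℝ × ℝ | p.2 ≤ p.1}.indicator fun p => deriv φ p.1 * h p.2) (x, s)
      = -(φ s * h s) := fun s => by
    have : ∫ x in Ici s, deriv φ x * h s = -(φ s * h s) := by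
      rw [integral_mul_const, integral_Ici_eq_integral_Ioi,
        hφ.hasCompactSupport.integral_Ioi_deriv_eq hφ.contDiff, neg_mul]
    rw [← this, ← integral_indicator measurableSet_Ici]
    rfl
  constructor
  · simpa only [h1] using hI.integral_prod_left
  · rw [← integral_neg]
    simp_rw [← h1, ← h2]
    exact integral_integral_swap hI

/-- Integration by parts for a function whose increments, between points of a set of full measure,
are those of a measure `h₁ • m₁ + h₂ • m₂`. -/
lemma IsTestFun.setIntegral_deriv_mul_of_increments (hab : a < b) (hφ : IsTestFun a b φ)
    {f : ℝ → ℝ} {T : Set ℝ} (hT : volume (Ioo a b \ T) = 0) (m₁ m₂ : Measure ℝ)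
    [IsFiniteMeasure m₁] [IsFiniteMeasure m₂] {h₁ h₂ : ℝ → ℝ} (hh₁ : Integrable h₁ m₁)
    (hh₂ : Integrable h₂ m₂)
    (hf : ∀ x ∈ Ioo a b ∩ T, ∀ y ∈ Ioo a b ∩ T, x < y →
      f y - f x = (∫ s in Ioc x y, h₁ s ∂m₁) + ∫ s in Ioc x y, h₂ s ∂m₂) :
    ∫ x in Ioo a b, deriv φ x * f x = -((∫ x, φ x * h₁ x ∂m₁) + ∫ x, φ x * h₂ x ∂m₂) := by
  obtain ⟨x₀, hx₀⟩ : (Ioo a b ∩ T).Nonempty := by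
    rw [nonempty_iff_ne_empty]
    intro h
    have : Ioo a b \ T = Ioo a b := by
      rw [← sdiff_self_inter, h, sdiff_empty]
    rw [this, Real.volume_Ioo, ENNReal.ofReal_eq_zero] at hT
    linarith
  have hIoc : ∀ (m : Measure ℝ) [IsFiniteMeasure m] (h : ℝ → ℝ), Integrable h m → ∀ x y, x ≤ y →
      ∫ s in Ioc x y, h s ∂m = (∫ s in Iic y, h s ∂m) - ∫ s in Iic x, h s ∂m := by
    intro m _ h hh x y hxy
    rw [← Iic_union_Ioc_eq_Iic hxy, setIntegral_union (by
      rw [Set.disjoint_left]; exact fun z hz hz' => not_lt.2 hz hz'.1) measurableSet_Ioc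
      hh.integrableOn hh.integrableOn]
    ring
  let G : ℝ → ℝ := fun x => (∫ s in Iic x, h₁ s ∂m₁) + ∫ s in Iic x, h₂ s ∂m₂
  have hfG : ∀ x ∈ Ioo a b ∩ T, f x = (f x₀ - G x₀) + G x := by
    intro x hx
    rcases lt_trichotomy x x₀ with h | h | h
    · have := hf x hx x₀ hx₀ h
      rw [hIoc m₁ h₁ hh₁ _ _ h.le, hIoc m₂ h₂ hh₂ _ _ h.le] at this
      simp only [G]; linarith
    · rw [h]; ring
    · have := hf x₀ hx₀ x hx h
      rw [hIoc m₁ h₁ hh₁ _ _ h.le, hIoc m₂ h₂ hh₂ _ _ h.le] at this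
      simp only [G]; linarith
  have hae : ∀ᵐ x ∂volume.restrict (Ioo a b), x ∈ T := by
    rw [ae_restrict_iff' measurableSet_Ioo, ae_iff]
    convert hT using 2
    ext x; simp [and_assoc]
  have hcongr : ∫ x in Ioo a b, deriv φ x * f x =
      ∫ x in Ioo a b, deriv φ x * ((f x₀ - G x₀) + G x) := by
    refine integral_congr_ae ?_
    filter_upwards [hae, ae_restrict_mem measurableSet_Ioo] with x hx hx'
    rw [hfG x ⟨hx', hx⟩]
  obtain ⟨i₁, e₁⟩ := hφ.integral_deriv_mul_setIntegral_Iic m₁ hh₁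
  obtain ⟨i₂, e₂⟩ := hφ.integral_deriv_mul_setIntegral_Iic m₂ hh₂
  rw [hcongr, hφ.setIntegral_deriv_mul]
  have : ∀ x, deriv φ x * ((f x₀ - G x₀) + G x) = deriv φ x * (f x₀ - G x₀) +
      (deriv φ x * (∫ s in Iic x, h₁ s ∂m₁) + deriv φ x * ∫ s in Iic x, h₂ s ∂m₂) := fun x => by
    simp only [G]; ring
  simp_rw [this]
  have i₁₂ : Integrable (fun x => deriv φ x * (∫ s in Iic x, h₁ s ∂m₁) +
      deriv φ x * ∫ s in Iic x, h₂ s ∂m₂) := i₁.add i₂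
  rw [integral_add (hφ.integrable_deriv.mul_const _) i₁₂, integral_add i₁ i₂, e₁, e₂,
    integral_mul_const, hφ.integral_deriv]
  ring

/-- The indicator function of an open subset of `]a, b[` is a bounded limit of test functions. -/
lemma exists_isTestFun_tendsto_indicator {V : Set ℝ} (hV : IsOpen V) (hVab : V ⊆ Ioo a b) :
    ∃ φ : ℕ → ℝ → ℝ, (∀ n, IsTestFun a b (φ n)) ∧ (∀ n x, ‖φ n x‖ ≤ 1) ∧
      ∀ x, Tendsto (fun n => φ n x) atTop (𝓝 (V.indicator (fun _ => 1) x)) := by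
  obtain ⟨ψ, hψs, hψc, hψr⟩ := hV.exists_contDiff_support_eq (n := 1)
  have hψ0 : ∀ x, 0 ≤ ψ x := fun x => (hψr (mem_range_self x)).1
  have hsupp : ∀ n : ℕ, tsupport (fun x => Real.smoothTransition (n * ψ x - 1)) ⊆ V := by
    intro n
    have h1 : tsupport (fun x => Real.smoothTransition (n * ψ x - 1)) ⊆ {x | 1 ≤ n * ψ x} := by
      refine closure_minimal (fun x hx => ?_)
        (isClosed_le continuous_const (continuous_const.mul hψc.continuous))
      by_contra h
      exact hx (Real.smoothTransition.zero_of_nonpos (by simp at h; linarith))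
    intro x hx
    rw [← hψs]
    intro h0
    have := h1 hx
    simp only [mem_ofPred_eq, h0, mul_zero] at this
    linarith
  refine ⟨fun n x => Real.smoothTransition (n * ψ x - 1), fun n => ⟨?_, ?_, ?_⟩, ?_, ?_⟩
  · exact Real.smoothTransition.contDiff.comp ((contDiff_const.mul hψc).sub contDiff_const)
  · refine HasCompactSupport.of_support_subset_isCompact (isCompact_Icc (a := a) (b := b)) ?_
    exact (subset_tsupport _).trans ((hsupp n).trans (hVab.trans Ioo_subset_Icc_self))
  · exact (hsupp n).trans hVab
  · intro n x
    rw [Real.norm_of_nonneg (Real.smoothTransition.nonneg _)]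
    exact Real.smoothTransition.le_one _
  · intro x
    by_cases hx : x ∈ V
    · have hpos : 0 < ψ x := lt_of_le_of_ne (hψ0 x) (Ne.symm (by rw [← hψs] at hx; exact hx))
      rw [indicator_of_mem hx]
      refine tendsto_const_nhds.congr' ?_
      have ht : Tendsto (fun n : ℕ => (n : ℝ) * ψ x) atTop atTop :=
        tendsto_natCast_atTop_atTop.atTop_mul_const hpos
      filter_upwards [ht.eventually_ge_atTop 2] with n hn
      exact (Real.smoothTransition.one_of_one_le (by linarith)).symm
    · have h0 : ψ x = 0 := by
        rw [← hψs] at hx; simpa using hx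
      simp [indicator_of_notMem hx, h0, Real.smoothTransition.zero_of_nonpos]

end TestFunctions

/-! ### The distributional derivative -/

section DistribDeriv

variable {a b : ℝ} {f : ℝ → ℝ}

lemma SignedMeasure.integral_eq_sub (ω : SignedMeasure ℝ) {φ : ℝ → ℝ} (hφ : Measurable φ) {C : ℝ}
    (hC : ∀ x, ‖φ x‖ ≤ C) : VectorMeasure.integral ω φ (ContinuousLinearMap.lsmul ℝ ℝ) =
      (∫ x, φ x ∂ω.toJordanDecomposition.posPart) - ∫ x, φ x ∂ω.toJordanDecomposition.negPart := by
  have hfl : (ContinuousLinearMap.lsmul ℝ ℝ : ℝ →L[ℝ] ℝ →L[ℝ] ℝ) =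
      (ContinuousLinearMap.lsmul ℝ ℝ).flip := by
    ext; simp
  have hi : ∀ m : Measure ℝ, IsFiniteMeasure m → Integrable φ m := fun m _ =>
    Integrable.of_bound hφ.aestronglyMeasurable C (Eventually.of_forall hC)
  conv_lhs => rw [← ω.toSignedMeasure_toJordanDecomposition, JordanDecomposition.toSignedMeasure]
  rw [VectorMeasure.integral_sub_vectorMeasure, hfl, VectorMeasure.integral_toSignedMeasure,
    VectorMeasure.integral_toSignedMeasure]
  · rw [VectorMeasure.Integrable, Measure.variation_toSignedMeasure]; exact hi _ inferInstance
  · rw [VectorMeasure.Integrable, Measure.variation_toSignedMeasure]; exact hi _ inferInstance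

lemma SignedMeasure.apply_eq_sub (ω : SignedMeasure ℝ) {A : Set ℝ} (hA : MeasurableSet A) :
    ω A = ω.toJordanDecomposition.posPart.real A - ω.toJordanDecomposition.negPart.real A :=
  SignedMeasure.apply_eq_posPart_real_sub_negPart_real ω hA

lemma isDistribDeriv_of_increments (hab : a < b) {ω : SignedMeasure ℝ}
    (hω : ∀ A, MeasurableSet A → Disjoint A (Ioo a b) → ω A = 0) {T : Set ℝ}
    (hT : volume (Ioo a b \ T) = 0)
    (hf : ∀ x ∈ Ioo a b ∩ T, ∀ y ∈ Ioo a b ∩ T, x < y → f y - f x = ω (Ioc x y)) :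
    IsDistribDeriv a b f ω := by
  refine ⟨hω, fun φ hφ => ?_⟩
  obtain ⟨C, hC⟩ := hφ.exists_bound
  rw [SignedMeasure.integral_eq_sub ω hφ.contDiff.continuous.measurable hC,
    hφ.setIntegral_deriv_mul_of_increments hab hT ω.toJordanDecomposition.posPart
      ω.toJordanDecomposition.negPart (h₁ := fun _ => 1) (h₂ := fun _ => -1)
      (integrable_const _) (integrable_const _)]
  · simp [integral_neg, sub_eq_add_neg]
  · intro x hx y hy hxy
    rw [hf x hx y hy hxy, SignedMeasure.apply_eq_sub ω measurableSet_Ioc]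
    simp [sub_eq_add_neg]

/-- The distributional derivative is unique, since test functions approximate the indicator
functions of open sets. -/
lemma IsDistribDeriv.unique {μ ν : SignedMeasure ℝ} (hμ : IsDistribDeriv a b f μ)
    (hν : IsDistribDeriv a b f ν) : μ = ν := by
  set P := μ.toJordanDecomposition.posPart + ν.toJordanDecomposition.negPart with hP
  set Q := ν.toJordanDecomposition.posPart + μ.toJordanDecomposition.negPart with hQ
  have htest : ∀ φ : ℝ → ℝ, IsTestFun a b φ → ∫ x, φ x ∂P = ∫ x, φ x ∂Q := by
    intro φ hφ
    obtain ⟨C, hC⟩ := hφ.exists_bound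
    have hi : ∀ m : Measure ℝ, IsFiniteMeasure m → Integrable φ m := fun m _ =>
      Integrable.of_bound hφ.contDiff.continuous.aestronglyMeasurable C (Eventually.of_forall hC)
    have h := (hμ.2 φ hφ).symm.trans (hν.2 φ hφ)
    rw [SignedMeasure.integral_eq_sub μ hφ.contDiff.continuous.measurable hC,
      SignedMeasure.integral_eq_sub ν hφ.contDiff.continuous.measurable hC] at h
    rw [hP, hQ, integral_add_measure (hi _ inferInstance) (hi _ inferInstance),
      integral_add_measure (hi _ inferInstance) (hi _ inferInstance)]
    linarith
  have hopen : ∀ V : Set ℝ, IsOpen V → V ⊆ Ioo a b → P V = Q V := by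
    intro V hV hVab
    obtain ⟨φ, hφ, hb, hlim⟩ := exists_isTestFun_tendsto_indicator hV hVab
    have hm : ∀ m : Measure ℝ, IsFiniteMeasure m →
        Tendsto (fun n => ∫ x, φ n x ∂m) atTop (𝓝 (m.real V)) := by
      intro m _
      rw [← integral_indicator_one hV.measurableSet]
      exact tendsto_integral_of_dominated_convergence (fun _ => 1)
        (fun n => (hφ n).contDiff.continuous.aestronglyMeasurable) (integrable_const _)
        (fun n => Eventually.of_forall (hb n)) (Eventually.of_forall hlim)
    have := tendsto_nhds_unique (hm P inferInstance)
      ((hm Q inferInstance).congr fun n => (htest _ (hφ n)).symm)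
    exact (measureReal_eq_measureReal_iff).1 this
  have hPQ : P.restrict (Ioo a b) = Q.restrict (Ioo a b) := by
    refine ext_of_generate_finite {s : Set ℝ | IsOpen s} BorelSpace.measurable_eq ?_ ?_ ?_
    · exact isPiSystem_isOpen
    · intro s hs
      replace hs : IsOpen s := hs
      rw [Measure.restrict_apply hs.measurableSet, Measure.restrict_apply hs.measurableSet]
      exact hopen _ (hs.inter isOpen_Ioo) inter_subset_right
    · rw [Measure.restrict_apply_univ, Measure.restrict_apply_univ]
      exact hopen _ isOpen_Ioo le_rfl
  have hsub : ∀ A, MeasurableSet A → A ⊆ Ioo a b → μ A = ν A := by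
    intro A hA hAab
    have h := congrArg (fun m : Measure ℝ => m.real A) hPQ
    simp only [measureReal_restrict_apply hA, inter_eq_self_of_subset_left hAab] at h
    rw [hP, hQ, measureReal_add_apply, measureReal_add_apply] at h
    rw [SignedMeasure.apply_eq_sub μ hA, SignedMeasure.apply_eq_sub ν hA]
    linarith
  ext A hA
  have hA1 := hA.inter (measurableSet_Ioo (a := a) (b := b))
  have hA2 := hA.diff (measurableSet_Ioo (a := a) (b := b))
  have hd : Disjoint (A ∩ Ioo a b) (A \ Ioo a b) :=
    disjoint_sdiff_right.mono_left inter_subset_right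
  rw [← inter_union_sdiff A (Ioo a b), VectorMeasure.of_union hd hA1 hA2,
    VectorMeasure.of_union hd hA1 hA2, hsub _ hA1 inter_subset_right,
    hμ.1 _ hA2 disjoint_sdiff_left, hν.1 _ hA2 disjoint_sdiff_left]

lemma IsDistribDeriv.distribDeriv_eq {μ : SignedMeasure ℝ} (hμ : IsDistribDeriv a b f μ) :
    distribDeriv a b f = μ := by
  have h : ∃ μ, IsDistribDeriv a b f μ := ⟨μ, hμ⟩
  rw [distribDeriv, dif_pos h]
  exact h.choose_spec.unique hμ

/-- The values of the distributional derivative on intervals and points, and its support. -/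
lemma distribDeriv_spec (hab : a < b) (hf : BoundedVariationOn f (Ioo a b))
    (hi : IntegrableOn f (Ioo a b)) :
    (∀ A, MeasurableSet A → Disjoint A (Ioo a b) → distribDeriv a b f A = 0) ∧
      (∀ x ∈ Ioo a b, ∀ y ∈ Ioo a b, x ≤ y →
        distribDeriv a b f (Ioc x y) = rightTrace f y - rightTrace f x) ∧
      ∀ x ∈ Ioo a b, distribDeriv a b f {x} = rightTrace f x - leftTrace f x := by
  obtain ⟨ω, h1, h2, h3⟩ := exists_stieltjes_vectorMeasure hab hf hi
  have hω : IsDistribDeriv a b f ω := by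
    refine isDistribDeriv_of_increments (T := {x | ContinuousAt f x}) hab h1 ?_ ?_
    · refine Countable.measure_zero ((countable_not_continuousAt hab hf).mono ?_) _
      exact fun x hx => ⟨hx.1, hx.2⟩
    · intro x hx y hy hxy
      rw [h2 x hx.1 y hy.1 hxy.le, rightTrace_eq_of_continuousAt hi hx.1 hx.2,
        rightTrace_eq_of_continuousAt hi hy.1 hy.2]
  rw [hω.distribDeriv_eq]
  exact ⟨h1, h2, h3⟩

end DistribDeriv

/-! ### Densities of signed measures and their dependence on a parameter -/

section Density

variable {m : Measure ℝ}

lemma integral_withDensityᵥ_lsmul {h : ℝ → ℝ} (hh : Integrable h m) {f : ℝ → ℝ}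
    (hf : AEStronglyMeasurable f m) {C : ℝ} (hC : ∀ᵐ x ∂m, ‖f x‖ ≤ C) :
    VectorMeasure.integral (m.withDensityᵥ h) f (ContinuousLinearMap.lsmul ℝ ℝ) =
      ∫ x, f x * h x ∂m := by
  have hfl : (ContinuousLinearMap.lsmul ℝ ℝ : ℝ →L[ℝ] ℝ →L[ℝ] ℝ) =
      (ContinuousLinearMap.lsmul ℝ ℝ).flip := by
    ext; simp
  have := isFiniteMeasure_withDensity_ofReal hh.2
  have := isFiniteMeasure_withDensity_ofReal hh.neg.2
  have hi : ∀ k : ℝ → ℝ, IsFiniteMeasure (m.withDensity fun x => ENNReal.ofReal (k x)) →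
      Integrable f (m.withDensity fun x => ENNReal.ofReal (k x)) := fun k _ =>
    Integrable.of_bound (hf.mono_ac (withDensity_absolutelyContinuous _ _)) C
      ((withDensity_absolutelyContinuous _ _).ae_le hC)
  have he : ∀ k : ℝ → ℝ, AEMeasurable k m →
      ∫ x, f x ∂(m.withDensity fun x => ENNReal.ofReal (k x)) = ∫ x, max (k x) 0 * f x ∂m := by
    intro k hk
    rw [integral_withDensity_eq_integral_toReal_smul₀ hk.ennreal_ofReal
      (Eventually.of_forall fun _ => ENNReal.ofReal_lt_top)]
    simp [ENNReal.toReal_ofReal']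
  have hint : ∀ k : ℝ → ℝ, Integrable k m → Integrable (fun x => max (k x) 0 * f x) m := by
    intro k hk
    exact hk.pos_part.mul_bdd hf hC
  rw [withDensityᵥ_eq_withDensity_pos_part_sub_withDensity_neg_part hh,
    VectorMeasure.integral_sub_vectorMeasure, hfl, VectorMeasure.integral_toSignedMeasure,
    VectorMeasure.integral_toSignedMeasure, he h hh.aemeasurable,
    he (fun x => -h x) hh.neg.aemeasurable, ← integral_sub (hint h hh) (hint (fun x => -h x) hh.neg)]
  · congr 1 with x
    rw [← sub_mul, mul_comm]
    congr 1
    rcases le_total 0 (h x) with h0 | h0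
    · rw [max_eq_left h0, max_eq_right (by linarith), sub_zero]
    · rw [max_eq_right h0, max_eq_left (by linarith)]; ring
  · rw [VectorMeasure.Integrable, Measure.variation_toSignedMeasure]; exact hi _ ‹_›
  · rw [VectorMeasure.Integrable, Measure.variation_toSignedMeasure]; exact hi _ ‹_›

/-- A bound of the measure `f • m` by a multiple of `μ` is a pointwise bound of `f` by the density of
the absolutely continuous part of `μ`. -/
lemma ae_abs_le_of_forall_setIntegral_le [IsFiniteMeasure m] {f : ℝ → ℝ} (hf : Integrable f m)
    (μ : Measure ℝ) [IsFiniteMeasure μ] {κ : ℝ}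
    (h : ∀ A, MeasurableSet A → |∫ x in A, f x ∂m| ≤ κ * μ.real A) :
    ∀ᵐ x ∂m, |f x| ≤ κ * (μ.rnDeriv m x).toReal := by
  -- on `Z`, which has full measure for `m`, `μ` is absolutely continuous
  obtain ⟨Z, hZ, hZ1, hZ2⟩ := μ.mutuallySingular_singularPart m
  have hc : Integrable (fun x => κ * (μ.rnDeriv m x).toReal) m :=
    Measure.integrable_toReal_rnDeriv.const_mul _
  have key : ∀ A, MeasurableSet A → |∫ x in A, f x ∂m| ≤
      ∫ x in A, κ * (μ.rnDeriv m x).toReal ∂m := by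
    intro A hA
    have hAZ : (A ∩ Z : Set ℝ) =ᵐ[m] A := by
      refine inter_ae_eq_left_of_ae_eq_univ ?_
      exact ae_eq_univ.2 hZ2
    have hμ : μ.real (A ∩ Z) = ∫ x in A ∩ Z, (μ.rnDeriv m x).toReal ∂m := by
      have h0 : (μ.singularPart m).real (A ∩ Z) = 0 := by
        rw [measureReal_def, measure_mono_null inter_subset_right hZ1, ENNReal.toReal_zero]
      rw [Measure.setIntegral_toReal_rnDeriv_eq_withDensity' (hA.inter hZ)]
      conv_lhs => rw [Measure.haveLebesgueDecomposition_add μ m, measureReal_add_apply, h0, zero_add]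
    rw [← setIntegral_congr_set hAZ, ← setIntegral_congr_set (f := fun x => κ * _) hAZ,
      integral_const_mul, ← hμ]
    exact h _ (hA.inter hZ)
  have h1 : f ≤ᵐ[m] fun x => κ * (μ.rnDeriv m x).toReal :=
    ae_le_of_forall_setIntegral_le hf hc fun A hA _ => (le_abs_self _).trans (key A hA)
  have h2 : -f ≤ᵐ[m] fun x => κ * (μ.rnDeriv m x).toReal :=
    ae_le_of_forall_setIntegral_le hf.neg hc fun A hA _ => by
      simp only [Pi.neg_apply, integral_neg]
      exact (neg_le_abs _).trans (key A hA)
  filter_upwards [h1, h2] with x hx1 hx2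
  exact abs_le'.2 ⟨hx1, hx2⟩

variable {E : Type*} [NormedAddCommGroup E] [TopologicalSpace.SeparableSpace E]

/-- A family of functions that is locally Lipschitz in the parameter `w` has versions which are
continuous in `w`: at almost every point the Lipschitz estimates hold simultaneously for all `w` of a
countable dense set, from which the function extends by continuity. -/
lemma exists_continuous_version {r : E → ℝ → ℝ} (hr : ∀ w, Measurable (r w))
    (hr0 : Integrable (r 0) m)
    (hlip : ∀ n : ℕ, ∃ c : ℝ → ℝ, Measurable c ∧ Integrable c m ∧ (∀ x, 0 ≤ c x) ∧
      ∀ w ∈ Metric.closedBall (0 : E) n, ∀ w' ∈ Metric.closedBall (0 : E) n,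
        ∀ᵐ x ∂m, |r w x - r w' x| ≤ c x * ‖w - w'‖) :
    ∃ ρ : ℝ → E → ℝ, (∀ x, Continuous (ρ x)) ∧ (∀ w, Measurable fun x => ρ x w) ∧
      (∀ w, (fun x => ρ x w) =ᵐ[m] r w) ∧
      ∀ n : ℕ, ∃ c : ℝ → ℝ, Integrable c m ∧
        ∀ᵐ x ∂m, ∀ w ∈ Metric.closedBall (0 : E) n, |ρ x w| ≤ c x := by
  choose c hcm hci hc0 hc using hlip
  let q : ℕ → E := TopologicalSpace.denseSeq E
  have hq : DenseRange q := TopologicalSpace.denseRange_denseSeq E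
  let G : Set ℝ := {x | ∀ n j k : ℕ, q j ∈ Metric.closedBall (0 : E) n →
    q k ∈ Metric.closedBall (0 : E) n → |r (q j) x - r (q k) x| ≤ c n x * ‖q j - q k‖}
  have hG : MeasurableSet G := by
    simp only [G, ofPred_forall]
    refine MeasurableSet.iInter fun n => MeasurableSet.iInter fun j => MeasurableSet.iInter fun k =>
      MeasurableSet.iInter fun _ => MeasurableSet.iInter fun _ => ?_
    exact measurableSet_le ((hr _).sub (hr _)).abs ((hcm n).mul_const _)
  have hGae : ∀ᵐ x ∂m, x ∈ G := by
    simp only [G, mem_ofPred_eq, ae_all_iff]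
    exact fun n j k hj hk => hc n _ hj _ hk
  -- the limit of `r · x` along the dense sequence exists for `x ∈ G`
  have hlim : ∀ x ∈ G, ∀ w, ∃ y, Tendsto (fun v => r v x) (𝓝[range q] w) (𝓝 y) := by
    intro x hx w
    obtain ⟨n, hn⟩ := exists_nat_gt ‖w‖
    have hL : LipschitzOnWith ⟨c n x, hc0 n x⟩ (fun v => r v x)
        (range q ∩ Metric.closedBall (0 : E) n) := by
      refine LipschitzOnWith.of_dist_le_mul ?_
      rintro _ ⟨⟨j, rfl⟩, hj⟩ _ ⟨⟨k, rfl⟩, hk⟩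
      rw [Real.dist_eq, dist_eq_norm]
      exact hx n j k hj hk
    obtain ⟨g, hg, hgr⟩ := hL.extend_real
    refine ⟨g w, (hg.continuous.continuousWithinAt (s := range q)).congr' ?_⟩
    have hball : Metric.closedBall (0 : E) n ∈ 𝓝 w :=
      mem_of_superset (Metric.isOpen_ball.mem_nhds (by simpa using hn)) Metric.ball_subset_closedBall
    filter_upwards [self_mem_nhdsWithin, mem_nhdsWithin_of_mem_nhds hball] with v hv hv'
    exact (hgr ⟨hv, hv'⟩).symm
  classical
  let ρ : ℝ → E → ℝ := fun x w => if x ∈ G then extendFrom (range q) (fun v => r v x) w else 0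
  have hρlim : ∀ x ∈ G, ∀ w, Tendsto (fun v => r v x) (𝓝[range q] w) (𝓝 (ρ x w)) := by
    intro x hx w
    simp only [ρ, hx, if_true]
    exact tendsto_extendFrom (hlim x hx w)
  have hρc : ∀ x, Continuous (ρ x) := by
    intro x
    by_cases hx : x ∈ G
    · simp only [ρ, hx, if_true]
      exact continuous_extendFrom hq (hlim x hx)
    · simp only [ρ, hx, if_false]
      exact continuous_const
  -- for each `w`, choose points of the dense sequence which converge to `w`
  have hseq : ∀ w : E, ∃ k : ℕ → ℕ, Tendsto (fun i => q (k i)) atTop (𝓝 w) := by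
    intro w
    obtain ⟨s, hs, hsl⟩ := mem_closure_iff_seq_limit.1 (hq w)
    choose k hk using hs
    exact ⟨k, by simpa only [hk] using hsl⟩
  have hwithin : ∀ (w : E) (k : ℕ → ℕ), Tendsto (fun i => q (k i)) atTop (𝓝 w) →
      Tendsto (fun i => q (k i)) atTop (𝓝[range q] w) := fun w k hk =>
    tendsto_nhdsWithin_iff.2 ⟨hk, Eventually.of_forall fun i => mem_range_self _⟩
  have hρm : ∀ w, Measurable fun x => ρ x w := by
    intro w
    obtain ⟨k, hk⟩ := hseq w
    refine measurable_of_tendsto_metrizable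
      (f := fun i x => if x ∈ G then r (q (k i)) x else 0)
      (fun i => Measurable.ite hG (hr _) measurable_const) (tendsto_pi_nhds.2 fun x => ?_)
    by_cases hx : x ∈ G
    · simp only [hx, if_true]
      exact (hρlim x hx w).comp (hwithin w k hk)
    · simp only [hx, if_false, ρ]
      exact tendsto_const_nhds
  have hρr : ∀ w, (fun x => ρ x w) =ᵐ[m] r w := by
    intro w
    obtain ⟨k, hk⟩ := hseq w
    obtain ⟨n, hn⟩ := exists_nat_gt ‖w‖
    have hball : Metric.closedBall (0 : E) n ∈ 𝓝 w :=
      mem_of_superset (Metric.isOpen_ball.mem_nhds (by simpa using hn)) Metric.ball_subset_closedBall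
    have h1 : ∀ᵐ x ∂m, ∀ i, q (k i) ∈ Metric.closedBall (0 : E) n →
        |r (q (k i)) x - r w x| ≤ c n x * ‖q (k i) - w‖ := by
      rw [ae_all_iff]
      intro i
      by_cases hi : q (k i) ∈ Metric.closedBall (0 : E) n
      · filter_upwards [hc n _ hi w (mem_of_mem_nhds hball)] with x hx _ using hx
      · exact Eventually.of_forall fun x h => absurd h hi
    filter_upwards [hGae, h1] with x hx hx1
    refine tendsto_nhds_unique ((hρlim x hx w).comp (hwithin w k hk)) ?_
    rw [tendsto_iff_dist_tendsto_zero]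
    have hz : Tendsto (fun i => c n x * ‖q (k i) - w‖) atTop (𝓝 0) := by
      have := (tendsto_iff_norm_sub_tendsto_zero.1 hk).const_mul (c n x)
      rwa [mul_zero] at this
    refine squeeze_zero' (Eventually.of_forall fun _ => dist_nonneg) ?_ hz
    filter_upwards [hk hball] with i hi
    exact hx1 i hi
  refine ⟨ρ, hρc, hρm, hρr, fun n => ⟨fun x => |r 0 x| + c (n + 1) x * (n + 1), ?_, ?_⟩⟩
  · exact hr0.abs.add ((hci (n + 1)).mul_const _)
  · have h0 : (0 : E) ∈ Metric.closedBall (0 : E) ((n + 1 : ℕ) : ℝ) := by simp; positivity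
    have h1 : ∀ᵐ x ∂m, ∀ k, q k ∈ Metric.closedBall (0 : E) ((n + 1 : ℕ) : ℝ) →
        |ρ x (q k)| ≤ |r 0 x| + c (n + 1) x * (n + 1) := by
      rw [ae_all_iff]
      intro k
      by_cases hk : q k ∈ Metric.closedBall (0 : E) ((n + 1 : ℕ) : ℝ)
      · filter_upwards [hc (n + 1) _ hk 0 h0, hρr (q k)] with x hx hx' _
        rw [hx']
        have h2 : ‖q k - 0‖ ≤ n + 1 := by simpa using hk
        have h3 : c (n + 1) x * ‖q k - 0‖ ≤ c (n + 1) x * (n + 1) :=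
          mul_le_mul_of_nonneg_left h2 (hc0 _ x)
        have h4 := abs_sub_abs_le_abs_sub (r (q k) x) (r 0 x)
        linarith
      · exact Eventually.of_forall fun x h => absurd h hk
    filter_upwards [h1] with x hx w hw
    have hcl : IsClosed {w | |ρ x w| ≤ |r 0 x| + c (n + 1) x * (n + 1)} :=
      isClosed_le (hρc x).abs continuous_const
    have hw' : w ∈ Metric.ball (0 : E) (n + 1) := by
      have : ‖w‖ ≤ n := by simpa using hw
      simp; linarith
    have hcl' : w ∈ closure (Metric.ball (0 : E) (n + 1) ∩ range q) :=
      Dense.open_subset_closure_inter hq Metric.isOpen_ball hw'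
    refine closure_minimal ?_ hcl hcl'
    rintro _ ⟨hv, k, rfl⟩
    refine hx k ?_
    push_cast
    exact Metric.ball_subset_closedBall hv

/-- For functions continuous in the parameter `w`, the exceptional null set can be chosen
independently of `w`. -/
lemma ae_eq_of_forall_ae_eq {g h : ℝ → E → ℝ} (hg : ∀ᵐ x ∂m, Continuous (g x))
    (hh : ∀ᵐ x ∂m, Continuous (h x)) (hgh : ∀ w, (fun x => g x w) =ᵐ[m] fun x => h x w) :
    ∀ᵐ x ∂m, ∀ w, g x w = h x w := by
  have h1 : ∀ᵐ x ∂m, ∀ k, g x (TopologicalSpace.denseSeq E k) =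
      h x (TopologicalSpace.denseSeq E k) := ae_all_iff.2 fun k => hgh _
  filter_upwards [hg, hh, h1] with x hx hx' h2 w
  refine congrFun (Continuous.ext_on (TopologicalSpace.denseRange_denseSeq E) hx hx' ?_) w
  rintro _ ⟨k, rfl⟩
  exact h2 k

end Density

/-! ### Points where the composition is regular -/

section RegularSet

variable {E : Type*} [NormedAddCommGroup E] [InnerProductSpace ℝ E] [FiniteDimensional ℝ E]
  {a b : ℝ} {B : ℝ → E → ℝ} {u : ℝ → E} {T : Set ℝ}

lemma norm_gradient_sub (f g : E → ℝ) (w : E) :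
    ‖gradient f w - gradient g w‖ = ‖fderiv ℝ f w - fderiv ℝ g w‖ := by
  rw [← toDual_gradient, ← toDual_gradient, ← map_sub, LinearIsometryEquiv.norm_map]

lemma norm_fderiv_eq_norm_gradient (f : E → ℝ) (w : E) : ‖fderiv ℝ f w‖ = ‖gradient f w‖ := by
  rw [← toDual_gradient, LinearIsometryEquiv.norm_map]

lemma continuous_gradient {f : E → ℝ} (hf : ContDiff ℝ 1 f) : Continuous (gradient f) := by
  have : gradient f = fun w => (InnerProductSpace.toDual ℝ E).symm (fderiv ℝ f w) := rfl
  rw [this]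
  exact (LinearIsometryEquiv.continuous _).comp (hf.continuous_fderiv one_ne_zero)

lemma abs_sub_le_of_gradient_le {f : E → ℝ} (hf : ContDiff ℝ 1 f) {R D : ℝ}
    (hD : ∀ w ∈ Metric.closedBall (0 : E) R, ‖gradient f w‖ ≤ D) {w w' : E}
    (hw : w ∈ Metric.closedBall (0 : E) R) (hw' : w' ∈ Metric.closedBall (0 : E) R) :
    |f w - f w'| ≤ D * ‖w - w'‖ := by
  rw [← Real.norm_eq_abs]
  refine (convex_closedBall (0 : E) R).norm_image_sub_le_of_norm_fderiv_le (𝕜 := ℝ)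
    (fun x _ => hf.differentiable one_ne_zero x) (fun x hx => ?_) hw' hw
  rw [norm_fderiv_eq_norm_gradient]
  exact hD x hx

lemma exists_mem_segment_sub_eq_inner_gradient {f : E → ℝ} (hf : ContDiff ℝ 1 f) (w w' : E) :
    ∃ z ∈ segment ℝ w w', f w' - f w = inner ℝ (gradient f z) (w' - w) := by
  obtain ⟨z, hz, h⟩ := domain_mvt (f := f) (s := univ) (x := w) (y := w') (f' := fderiv ℝ f)
    (fun x _ => (hf.differentiable one_ne_zero x).hasFDerivAt.hasFDerivWithinAt) convex_univ
    (mem_univ _) (mem_univ _)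
  refine ⟨z, hz, ?_⟩
  rw [h, ← toDual_gradient, InnerProductSpace.toDual_apply_apply]

/-- A countable set is avoided by points of `]a, b[` arbitrarily close to `s` on its right. -/
lemma neBot_nhdsGT_diff {N : Set ℝ} (hN : N.Countable) {s : ℝ} (hs : s ∈ Ioo a b) :
    (𝓝[Ioi s ∩ (Ioo a b \ N)] s).NeBot := by
  rw [← mem_closure_iff_nhdsWithin_neBot]
  have h1 : Ioo s b ⊆ closure (Ioo s b ∩ Nᶜ) :=
    (hN.dense_compl ℝ).open_subset_closure_inter isOpen_Ioo
  have h2 : s ∈ closure (Ioo s b) := by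
    rw [closure_Ioo hs.2.ne]; exact ⟨le_rfl, hs.2.le⟩
  refine closure_mono ?_ (closure_minimal h1 isClosed_closure h2)
  exact fun x hx => ⟨hx.1.1, ⟨hs.1.trans hx.1.1, hx.1.2⟩, hx.2⟩

lemma neBot_nhdsLT_diff {N : Set ℝ} (hN : N.Countable) {s : ℝ} (hs : s ∈ Ioo a b) :
    (𝓝[Iio s ∩ (Ioo a b \ N)] s).NeBot := by
  rw [← mem_closure_iff_nhdsWithin_neBot]
  have h1 : Ioo a s ⊆ closure (Ioo a s ∩ Nᶜ) :=
    (hN.dense_compl ℝ).open_subset_closure_inter isOpen_Ioo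
  have h2 : s ∈ closure (Ioo a s) := by
    rw [closure_Ioo hs.1.ne]; exact ⟨hs.1.le, le_rfl⟩
  refine closure_mono ?_ (closure_minimal h1 isClosed_closure h2)
  exact fun x hx => ⟨hx.1.2, ⟨hx.1.1, hx.1.2.trans hs.2⟩, hx.2⟩

/-- `T` is a set of points of `]a, b[`, with countable complement, at which `u` is continuous, the
sections `B(·, w)` have no jump and the gradient `D_w B` is jointly continuous (along `T`), with
local bounds for this gradient. -/
structure IsRegularSet (a b : ℝ) (B : ℝ → E → ℝ) (u : ℝ → E) (T : Set ℝ) : Prop where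
  subset : T ⊆ Ioo a b
  countable : (Ioo a b \ T).Countable
  continuousAt : ∀ s ∈ T, ContinuousAt u s
  contDiff : ∀ s ∈ T, ContDiff ℝ 1 (B s)
  bound : ∀ R : ℝ, ∃ D, 0 ≤ D ∧ ∀ s ∈ T, ∀ w ∈ Metric.closedBall (0 : E) R, ‖gradient (B s) w‖ ≤ D
  boundedVariationOn : ∀ w, BoundedVariationOn (fun x => B x w) (Ioo a b)
  integrableOn : ∀ w, IntegrableOn (fun x => B x w) (Ioo a b)
  rightTrace_eq : ∀ s ∈ T, ∀ w, rightTrace (fun x => B x w) s = B s w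
  leftTrace_eq : ∀ s ∈ T, ∀ w, leftTrace (fun x => B x w) s = B s w
  tendsto_gradient : ∀ s ∈ T, ∀ w,
    Tendsto (fun p : ℝ × E => gradient (B p.1) p.2) (𝓝[T] s ×ˢ 𝓝 w) (𝓝 (gradient (B s) w))

/-- Off a countable set, the sections `B(·, w)` are continuous along its complement for all `w` at
once, since this holds for `w` in a countable dense set and `B(x, ·)` is locally Lipschitz, uniformly
in `x`. -/
lemma tendsto_section {N : Set ℝ} {q : ℕ → E} (hq : DenseRange q)
    (hC1 : ∀ x ∈ Ioo a b \ N, ContDiff ℝ 1 (B x))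
    (hgrad : ∀ R : ℝ, ∃ D, 0 < D ∧ ∀ x ∈ Ioo a b \ N, ∀ w ∈ Metric.closedBall (0 : E) R,
      ‖gradient (B x) w‖ ≤ D) {s : ℝ} (hs : s ∈ Ioo a b \ N)
    (hsq : ∀ k, ContinuousAt (fun x => B x (q k)) s) (w : E) :
    Tendsto (fun x => B x w) (𝓝[Ioo a b \ N] s) (𝓝 (B s w)) := by
  obtain ⟨D, hD0, hD⟩ := hgrad (‖w‖ + 1)
  rw [Metric.tendsto_nhds]
  intro ε hε
  obtain ⟨k, hk⟩ := hq.exists_dist_lt w (ε := min 1 (ε / (4 * D))) (by positivity)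
  have hk1 : dist w (q k) < 1 := hk.trans_le (min_le_left _ _)
  have hk2 : D * dist w (q k) ≤ ε / 4 := by
    have := (hk.trans_le (min_le_right _ _)).le
    rw [le_div_iff₀ (by positivity)] at this
    linarith
  have hw : w ∈ Metric.closedBall (0 : E) (‖w‖ + 1) := by simp
  have hqk : q k ∈ Metric.closedBall (0 : E) (‖w‖ + 1) := by
    rw [mem_closedBall_zero_iff]
    have := norm_le_norm_add_norm_sub w (q k)
    rw [← dist_eq_norm] at this
    linarith
  have hL : ∀ y ∈ Ioo a b \ N, |B y w - B y (q k)| ≤ ε / 4 := fun y hy =>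
    (abs_sub_le_of_gradient_le (hC1 y hy) (hD y hy) hw hqk).trans (by rwa [← dist_eq_norm])
  filter_upwards [self_mem_nhdsWithin, nhdsWithin_le_nhds
    (Metric.tendsto_nhds.1 (hsq k) (ε / 4) (by positivity))] with y hy hy'
  have h1 := hL y hy
  have h2 := hL s hs
  rw [Real.dist_eq] at hy' ⊢
  rw [abs_le] at h1 h2
  rw [abs_lt] at hy' ⊢
  constructor <;> linarith [h1.1, h1.2, h2.1, h2.2, hy'.1, hy'.2]

/-- The regular set is the complement of `N`, of the discontinuities of `u` and of `B(·, w)` for `w` in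
a countable dense set, and of the atoms of the measures `μ n`. At the remaining points the gradient
`D_w B` is continuous in `x`, locally uniformly in `w`, because the difference of `D_w B` between two
points is bounded by the mass of `μ n` between them. -/
lemma exists_isRegularSet (hab : a < b) {N : Set ℝ} (hN : N.Countable)
    (hBV : ∀ w, BoundedVariationOn (fun x => B x w) (Ioo a b))
    (hBi : ∀ w, IntegrableOn (fun x => B x w) (Ioo a b))
    (hC1 : ∀ x ∈ Ioo a b \ N, ContDiff ℝ 1 (B x))
    (hgrad : ∀ R : ℝ, ∃ D, 0 < D ∧ ∀ x ∈ Ioo a b \ N, ∀ w ∈ Metric.closedBall (0 : E) R,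
      ‖gradient (B x) w‖ ≤ D)
    {μ : ℕ → Measure ℝ} [∀ n, IsFiniteMeasure (μ n)]
    (hμ : ∀ n : ℕ, ∀ w ∈ Metric.closedBall (0 : E) n, ∀ w' ∈ Metric.closedBall (0 : E) n,
      ∀ A, MeasurableSet A → A ⊆ Ioo a b →
        |distribDeriv a b (fun x => B x w) A - distribDeriv a b (fun x => B x w') A| ≤
          ‖w - w'‖ * (μ n).real A)
    (hu : BoundedVariationOn u (Ioo a b)) :
    ∃ T, IsRegularSet a b B u T ∧ Disjoint T N := by
  let q : ℕ → E := TopologicalSpace.denseSeq E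
  have hq : DenseRange q := TopologicalSpace.denseRange_denseSeq E
  let C : Set ℝ := N ∪ (⋃ k, {x ∈ Ioo a b | ¬ ContinuousAt (fun x => B x (q k)) x}) ∪
    {x ∈ Ioo a b | ¬ ContinuousAt u x} ∪ ⋃ n, {x | 0 < μ n {x}}
  have hC : C.Countable := by
    refine ((hN.union (countable_iUnion fun k => countable_not_continuousAt hab (hBV _))).union
      (countable_not_continuousAt hab hu)).union (countable_iUnion fun n => ?_)
    exact Measure.countable_meas_pos_of_disjoint_iUnion (fun x => measurableSet_singleton x)
      (fun x y hxy => by simpa using hxy)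
  have hTN : ∀ s ∈ Ioo a b \ C, s ∈ Ioo a b \ N := fun s hs =>
    ⟨hs.1, fun h => hs.2 (Or.inl (Or.inl (Or.inl h)))⟩
  have hTq : ∀ s ∈ Ioo a b \ C, ∀ k, ContinuousAt (fun x => B x (q k)) s := fun s hs k => by
    by_contra h
    exact hs.2 (Or.inl (Or.inl (Or.inr (mem_iUnion.2 ⟨k, hs.1, h⟩))))
  have hTμ : ∀ s ∈ Ioo a b \ C, ∀ n, μ n {s} = 0 := fun s hs n => by
    by_contra h
    exact hs.2 (Or.inr (mem_iUnion.2 ⟨n, pos_iff_ne_zero.2 h⟩))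
  have hR : ∀ s ∈ Ioo a b \ C, ∀ w, rightTrace (fun x => B x w) s = B s w := fun s hs w => by
    have := neBot_nhdsGT_diff hN hs.1
    exact tendsto_nhds_unique ((tendsto_rightTrace (hBV w) (hBi w) hs.1).mono_left
      (nhdsWithin_mono _ inter_subset_left)) ((tendsto_section hq hC1 hgrad (hTN s hs) (hTq s hs)
      w).mono_left (nhdsWithin_mono _ inter_subset_right))
  have hL : ∀ s ∈ Ioo a b \ C, ∀ w, leftTrace (fun x => B x w) s = B s w := fun s hs w => by
    have := neBot_nhdsLT_diff hN hs.1
    exact tendsto_nhds_unique ((tendsto_leftTrace (hBV w) (hBi w) hs.1).mono_left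
      (nhdsWithin_mono _ inter_subset_left)) ((tendsto_section hq hC1 hgrad (hTN s hs) (hTq s hs)
      w).mono_left (nhdsWithin_mono _ inter_subset_right))
  -- the Lipschitz constant of `B t - B s` is controlled by the mass of `]s, t]`
  have hlt : ∀ s ∈ Ioo a b \ C, ∀ t ∈ Ioo a b \ C, s < t → ∀ n : ℕ,
      ∀ w ∈ Metric.ball (0 : E) n, ‖gradient (B t) w - gradient (B s) w‖ ≤
        (μ n).real (Ioc s t) := by
    intro s hs t ht hst n w hw
    have hlip : LipschitzOnWith ⟨(μ n).real (Ioc s t), measureReal_nonneg⟩ (B t - B s)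
        (Metric.closedBall (0 : E) n) := by
      refine LipschitzOnWith.of_dist_le_mul fun v hv v' hv' => ?_
      have h := hμ n v hv v' hv' (Ioc s t) measurableSet_Ioc
        (fun z hz => ⟨hs.1.1.trans hz.1, hz.2.trans_lt ht.1.2⟩)
      rw [(distribDeriv_spec hab (hBV v) (hBi v)).2.1 s hs.1 t ht.1 hst.le,
        (distribDeriv_spec hab (hBV v') (hBi v')).2.1 s hs.1 t ht.1 hst.le,
        hR s hs, hR s hs, hR t ht, hR t ht] at h
      rw [Real.dist_eq, dist_eq_norm, mul_comm]
      exact h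
    rw [norm_gradient_sub, ← fderiv_sub ((hC1 t (hTN t ht)).differentiable one_ne_zero w)
      ((hC1 s (hTN s hs)).differentiable one_ne_zero w)]
    exact norm_fderiv_le_of_lipschitzOn ℝ (mem_of_superset (Metric.isOpen_ball.mem_nhds hw)
      Metric.ball_subset_closedBall) hlip
  refine ⟨Ioo a b \ C, ⟨sdiff_subset, ?_, ?_, fun s hs => hC1 s (hTN s hs), ?_, hBV, hBi, hR, hL,
    ?_⟩, ?_⟩
  · refine hC.mono fun x hx => ?_
    by_contra h
    exact hx.2 ⟨hx.1, h⟩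
  · intro s hs
    by_contra h
    exact hs.2 (Or.inl (Or.inr ⟨hs.1, h⟩))
  · intro R
    obtain ⟨D, hD0, hD⟩ := hgrad R
    exact ⟨D, hD0.le, fun s hs => hD s (hTN s hs)⟩
  · intro s hs w
    obtain ⟨n, hn⟩ := exists_nat_gt ‖w‖
    rw [tendsto_iff_norm_sub_tendsto_zero]
    have h1 : Tendsto (fun p : ℝ × E => (μ n).real (Icc (s - |p.1 - s|) (s + |p.1 - s|)))
        (𝓝[Ioo a b \ C] s ×ˢ 𝓝 w) (𝓝 0) := by
      have hz : Tendsto (fun δ => (μ n).real (Icc (s - δ) (s + δ))) (𝓝[≥] 0) (𝓝 0) := by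
        have := (ENNReal.tendsto_toReal (by rw [hTμ s hs n]; simp)).comp
          (tendsto_measure_Icc_nhdsWithin_right (μ n) s)
        rwa [hTμ s hs n, ENNReal.toReal_zero] at this
      refine hz.comp (tendsto_nhdsWithin_iff.2
        ⟨?_, Eventually.of_forall fun p => mem_Ici.2 (abs_nonneg _)⟩)
      have : Tendsto (fun x : ℝ => |x - s|) (𝓝[Ioo a b \ C] s) (𝓝 0) := by
        have : Tendsto (fun x : ℝ => |x - s|) (𝓝 s) (𝓝 |s - s|) :=
          (continuous_abs.comp (continuous_id.sub continuous_const)).tendsto s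
        rw [sub_self, abs_zero] at this
        exact this.mono_left nhdsWithin_le_nhds
      exact this.comp tendsto_fst
    have h2 : Tendsto (fun p : ℝ × E => ‖gradient (B s) p.2 - gradient (B s) w‖)
        (𝓝[Ioo a b \ C] s ×ˢ 𝓝 w) (𝓝 0) :=
      (tendsto_iff_norm_sub_tendsto_zero.1
        ((continuous_gradient (hC1 s (hTN s hs))).tendsto w)).comp tendsto_snd
    have h3 := h1.add h2
    rw [add_zero] at h3
    refine squeeze_zero' (Eventually.of_forall fun _ => norm_nonneg _) ?_ h3
    have hw : w ∈ Metric.ball (0 : E) n := by simpa using hn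
    filter_upwards [prod_mem_prod self_mem_nhdsWithin (Metric.isOpen_ball.mem_nhds hw)]
      with p hp
    have key : ‖gradient (B p.1) p.2 - gradient (B s) p.2‖ ≤
        (μ n).real (Icc (s - |p.1 - s|) (s + |p.1 - s|)) := by
      rcases lt_trichotomy p.1 s with h | h | h
      · rw [← norm_neg, neg_sub]
        refine (hlt p.1 hp.1 s hs h n p.2 hp.2).trans (measureReal_mono fun z hz => ?_)
        rw [abs_of_neg (by linarith)]
        exact ⟨by linarith [hz.1], by linarith [hz.2]⟩
      · rw [h, sub_self, norm_zero]; exact measureReal_nonneg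
      · refine (hlt s hs p.1 hp.1 h n p.2 hp.2).trans (measureReal_mono fun z hz => ?_)
        rw [abs_of_pos (by linarith)]
        exact ⟨by linarith [hz.1], by linarith [hz.2]⟩
    calc ‖gradient (B p.1) p.2 - gradient (B s) w‖
        ≤ ‖gradient (B p.1) p.2 - gradient (B s) p.2‖ + ‖gradient (B s) p.2 - gradient (B s) w‖ :=
          norm_sub_le_norm_sub_add_norm_sub _ _ _
      _ ≤ _ := by gcongr
  · exact Set.disjoint_left.2 fun s hs => (hTN s hs).2

namespace IsRegularSet

lemma measurableSet (hT : IsRegularSet a b B u T) : MeasurableSet T := by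
  have : T = Ioo a b \ (Ioo a b \ T) := by
    rw [sdiff_sdiff_right_self]; exact (inter_eq_self_of_subset_right hT.subset).symm
  rw [this]
  exact measurableSet_Ioo.diff hT.countable.measurableSet

lemma abs_sub_le (hT : IsRegularSet a b B u T) (R : ℝ) : ∃ D, 0 ≤ D ∧ ∀ s ∈ T,
    ∀ w ∈ Metric.closedBall (0 : E) R, ∀ w' ∈ Metric.closedBall (0 : E) R,
      |B s w - B s w'| ≤ D * ‖w - w'‖ := by
  obtain ⟨D, hD0, hD⟩ := hT.bound R
  exact ⟨D, hD0, fun s hs w hw w' hw' => abs_sub_le_of_gradient_le (hT.contDiff s hs) (hD s hs) hw hw'⟩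

/-- Joint left limits of `B` along the regular set. -/
lemma tendsto_leftTrace (hT : IsRegularSet a b B u T) {s : ℝ} (hs : s ∈ Ioo a b) (w : E) :
    Tendsto (fun p : ℝ × E => B p.1 p.2) (𝓝[T ∩ Iio s] s ×ˢ 𝓝 w)
      (𝓝 (leftTrace (fun x => B x w) s)) := by
  obtain ⟨D, hD0, hD⟩ := hT.abs_sub_le (‖w‖ + 1)
  have h1 : Tendsto (fun p : ℝ × E => B p.1 w) (𝓝[T ∩ Iio s] s ×ˢ 𝓝 w)
      (𝓝 (leftTrace (fun x => B x w) s)) :=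
    ((BVChain.tendsto_leftTrace (hT.boundedVariationOn w) (hT.integrableOn w) hs).mono_left
      (nhdsWithin_mono _ inter_subset_right)).comp tendsto_fst
  refine h1.congr_dist ?_
  have h2 : Tendsto (fun p : ℝ × E => D * ‖p.2 - w‖) (𝓝[T ∩ Iio s] s ×ˢ 𝓝 w) (𝓝 0) := by
    have := ((tendsto_iff_norm_sub_tendsto_zero.1 (tendsto_id (x := 𝓝 w))).comp
      (tendsto_snd (f := 𝓝[T ∩ Iio s] s))).const_mul D
    rwa [mul_zero] at this
  refine squeeze_zero' (Eventually.of_forall fun _ => dist_nonneg) ?_ h2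
  filter_upwards [prod_mem_prod self_mem_nhdsWithin (Metric.closedBall_mem_nhds w one_pos)]
    with p hp
  rw [dist_comm, Real.dist_eq]
  refine hD p.1 hp.1.1 p.2 ?_ w (by simp)
  have h3 := norm_le_norm_add_norm_sub' p.2 w
  have h4 := hp.2
  rw [Metric.mem_closedBall, dist_eq_norm] at h4
  rw [mem_closedBall_zero_iff]
  linarith

end IsRegularSet

end RegularSet

/-! ### Partitions avoiding a countable set -/

section Partition

/-- Partitions of `[x, y]` into `n + 1` intervals of length at most `2 (y - x) / (n + 1)`, whose
nodes avoid a countable set. -/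
lemma exists_partition {C : Set ℝ} (hC : C.Countable) {x y : ℝ} (hxy : x < y) (hx : x ∉ C)
    (hy : y ∉ C) : ∃ t : ℕ → ℕ → ℝ, (∀ n, t n 0 = x) ∧ (∀ n, t n (n + 1) = y) ∧
      (∀ n, Monotone (t n)) ∧ (∀ n i, t n i ∉ C) ∧ (∀ n i, t n i ∈ Icc x y) ∧
      ∀ n i, t n (i + 1) - t n i ≤ 2 * (y - x) * (1 / ((n : ℝ) + 1)) := by
  -- the `i`-th node lies in the `i`-th cell of the uniform partition, which gives the factor `2`
  have hex : ∀ n i : ℕ, ∃ c ∈ Ioo (x + ((i : ℝ) - 1) * ((y - x) / (n + 1)))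
      (x + (i : ℝ) * ((y - x) / (n + 1))), c ∉ C := by
    intro n i
    have hδ : 0 < (y - x) / ((n : ℝ) + 1) := div_pos (by linarith) (by positivity)
    obtain ⟨c, hc, hcC⟩ := (hC.dense_compl ℝ).exists_between
      (show x + ((i : ℝ) - 1) * ((y - x) / (n + 1)) < x + (i : ℝ) * ((y - x) / (n + 1)) by
        nlinarith)
    exact ⟨c, hcC, hc⟩
  choose c hc hcC using hex
  let t : ℕ → ℕ → ℝ := fun n i => if i = 0 then x else if i ≤ n then c n i else y
  have hstep : ∀ n i, 0 ≤ t n (i + 1) - t n i ∧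
      t n (i + 1) - t n i ≤ 2 * (y - x) * (1 / ((n : ℝ) + 1)) := by
    intro n i
    set δ := (y - x) / ((n : ℝ) + 1) with hδ
    have hδ0 : 0 < δ := div_pos (by linarith) (by positivity)
    have hδy : y = x + (n + 1) * δ := by rw [hδ]; field_simp; ring
    have h2 : 2 * (y - x) * (1 / ((n : ℝ) + 1)) = 2 * δ := by rw [hδ]; ring
    rw [h2]
    have hci := hc n i
    have hci1 := hc n (i + 1)
    rw [← hδ] at hci hci1
    push_cast at hci1
    rw [show (i : ℝ) + 1 - 1 = i by ring] at hci1
    by_cases hi0 : i = 0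
    · subst hi0
      by_cases hn : 1 ≤ n
      · simp only [t, if_true, zero_add, one_ne_zero, if_false, hn]
        simp only [Nat.cast_zero, zero_mul, zero_add, one_mul, add_zero] at hci1
        constructor <;> linarith [hci1.1, hci1.2]
      · have hn0 : n = 0 := by omega
        subst hn0
        simp only [t, if_true, zero_add, one_ne_zero, if_false, hn]
        simp only [Nat.cast_zero, zero_add, one_mul] at hδy
        constructor <;> linarith
    · by_cases hin : i + 1 ≤ n
      · simp only [t, hi0, if_false, Nat.succ_ne_zero, hin, (Nat.le_succ i).trans hin, if_true]
        constructor <;> nlinarith [hci.1, hci.2, hci1.1, hci1.2]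
      · by_cases hin' : i ≤ n
        · have : i = n := by omega
          subst this
          simp only [t, hi0, if_false, Nat.succ_ne_zero, hin, le_refl, if_true]
          constructor <;> nlinarith [hci.1, hci.2]
        · simp only [t, hi0, if_false, Nat.succ_ne_zero, hin, hin']
          constructor <;> linarith
  have hmono : ∀ n, Monotone (t n) := fun n =>
    monotone_nat_of_le_succ fun i => sub_nonneg.1 (hstep n i).1
  have h0 : ∀ n, t n 0 = x := fun n => by simp [t]
  have h1 : ∀ n i, n + 1 ≤ i → t n i = y := fun n i hi => by
    simp [t, show i ≠ 0 by omega, show ¬ i ≤ n by omega]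
  refine ⟨t, h0, fun n => h1 n _ le_rfl, hmono, fun n i => ?_, fun n i => ⟨?_, ?_⟩,
    fun n i => (hstep n i).2⟩
  · simp only [t]
    split_ifs
    exacts [hx, hcC n i, hy]
  · rw [← h0 n]; exact hmono n (Nat.zero_le i)
  · rw [← h1 n (max i (n + 1)) (le_max_right _ _)]
    exact hmono n (le_max_left _ _)

lemma exists_mem_Ioc_of_monotone {t : ℕ → ℝ} {n : ℕ} {s : ℝ} (hs : s ∈ Ioc (t 0) (t n)) :
    ∃ i < n, s ∈ Ioc (t i) (t (i + 1)) := by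
  classical
  have hex : ∃ j, s ≤ t j := ⟨n, hs.2⟩
  have hpos : Nat.find hex ≠ 0 := fun h => by
    have := Nat.find_spec hex
    rw [h] at this
    exact not_lt.2 this hs.1
  obtain ⟨i, hi⟩ := Nat.exists_eq_succ_of_ne_zero hpos
  have hle : Nat.find hex ≤ n := Nat.find_min' hex hs.2
  refine ⟨i, by omega, ?_, ?_⟩
  · exact not_le.1 (Nat.find_min hex (by omega))
  · have := Nat.find_spec hex
    rwa [hi] at this

/-- Dominated convergence for sums of integrals over the cells of a sequence of partitions. -/
lemma tendsto_sum_setIntegral_cells {m : Measure ℝ} {t : ℕ → ℕ → ℝ} {x y : ℝ}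
    (h0 : ∀ n, t n 0 = x) (h1 : ∀ n, t n (n + 1) = y) (hmono : ∀ n, Monotone (t n))
    {h : ℕ → ℕ → ℝ → ℝ} {H bound : ℝ → ℝ} (hint : ∀ n i, Integrable (h n i) m)
    (hbi : Integrable bound m)
    (hb : ∀ n i, ∀ᵐ s ∂m, s ∈ Ioc x y → |h n i s| ≤ bound s)
    (hlim : ∀ᵐ s ∂m, s ∈ Ioc x y → ∀ i : ℕ → ℕ,
      (∀ n, s ∈ Ioc (t n (i n)) (t n (i n + 1))) →
      Tendsto (fun n => h n (i n) s) atTop (𝓝 (H s))) :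
    Tendsto (fun n => ∑ i ∈ Finset.range (n + 1), ∫ s in Ioc (t n i) (t n (i + 1)), h n i s ∂m)
      atTop (𝓝 (∫ s in Ioc x y, H s ∂m)) := by
  let S : ℕ → ℝ → ℝ := fun n s =>
    ∑ i ∈ Finset.range (n + 1), (Ioc (t n i) (t n (i + 1))).indicator (h n i) s
  have hS : ∀ n, ∑ i ∈ Finset.range (n + 1), ∫ s in Ioc (t n i) (t n (i + 1)), h n i s ∂m =
      ∫ s, S n s ∂m := by
    intro n
    rw [integral_finsetSum _ fun i _ => (hint n i).indicator measurableSet_Ioc]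
    exact Finset.sum_congr rfl fun i _ => (integral_indicator measurableSet_Ioc).symm
  have hSin : ∀ n i, ∀ s ∈ Ioc (t n i) (t n (i + 1)), i < n + 1 → S n s = h n i s := by
    intro n i s hs hi
    simp only [S]
    rw [Finset.sum_eq_single_of_mem i (Finset.mem_range.2 hi), indicator_of_mem hs]
    intro j _ hji
    refine indicator_of_notMem (fun hj => ?_) _
    exact Set.disjoint_left.1 ((hmono n).pairwise_disjoint_on_Ioc_succ hji) hj hs
  have hcell : ∀ n, ∀ s ∈ Ioc x y, ∃ i < n + 1, s ∈ Ioc (t n i) (t n (i + 1)) := fun n s hs =>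
    exists_mem_Ioc_of_monotone (by rwa [h0, h1])
  have hSout : ∀ n, ∀ s ∉ Ioc x y, S n s = 0 := by
    intro n s hs
    refine Finset.sum_eq_zero fun i hi => indicator_of_notMem (fun hmem => hs ?_) _
    rw [← h0 n, ← h1 n]
    exact ⟨(hmono n (Nat.zero_le i)).trans_lt hmem.1,
      hmem.2.trans (hmono n (Nat.succ_le_of_lt (Finset.mem_range.1 hi)))⟩
  simp_rw [hS]
  rw [← integral_indicator measurableSet_Ioc]
  refine tendsto_integral_of_dominated_convergence (fun s => |bound s|) (fun n => ?_) hbi.abs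
    (fun n => ?_) ?_
  · exact (integrable_finsetSum _ fun i _ =>
      (hint n i).indicator measurableSet_Ioc).aestronglyMeasurable
  · filter_upwards [ae_all_iff.2 fun i => hb n i] with s hs
    by_cases hsxy : s ∈ Ioc x y
    · obtain ⟨i, hi, hsi⟩ := hcell n s hsxy
      rw [hSin n i s hsi hi, Real.norm_eq_abs]
      exact (hs i hsxy).trans (le_abs_self _)
    · rw [hSout n s hsxy, norm_zero]; exact abs_nonneg _
  · filter_upwards [hlim] with s hs
    by_cases hsxy : s ∈ Ioc x y
    · choose i hi hsi using fun n => hcell n s hsxy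
      rw [indicator_of_mem hsxy]
      exact (hs hsxy i hsi).congr fun n => (hSin n (i n) s (hsi n) (hi n)).symm
    · rw [indicator_of_notMem hsxy]
      exact tendsto_const_nhds.congr fun n => (hSout n s hsxy).symm

end Partition

/-! ### The increments of the composition -/

section Increment

variable {E : Type*} [NormedAddCommGroup E] [InnerProductSpace ℝ E] [FiniteDimensional ℝ E]
  {a b : ℝ} {B : ℝ → E → ℝ} {u : ℝ → E} {T : Set ℝ}

open scoped Classical in
/-- The density, with respect to a measure `κ` with `Du = θ • κ`, of the part of the derivative of
`B(x, u(x))` which is due to the variation of `u`. At the points off the regular set `T` it accounts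
for the atom `B(s₋, u(s₊)) - B(s₋, u(s₋))`. -/
noncomputable def innerDensity (B : ℝ → E → ℝ) (u : ℝ → E) (T : Set ℝ) (κ : Measure ℝ) (θ : ℝ → E)
    (s : ℝ) : ℝ :=
  if s ∈ T then inner ℝ (gradient (B s) (u s)) (θ s)
  else (κ.real {s})⁻¹ * (leftTrace (fun x => B x (rightTrace u s)) s -
    leftTrace (fun x => B x (leftTrace u s)) s)

namespace IsRegularSet

lemma rightTrace_eq_self (hT : IsRegularSet a b B u T) (hui : IntegrableOn u (Ioo a b)) {s : ℝ}
    (hs : s ∈ T) : rightTrace u s = u s :=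
  rightTrace_eq_of_continuousAt hui (hT.subset hs) (hT.continuousAt s hs)

lemma leftTrace_eq_self (hT : IsRegularSet a b B u T) (hui : IntegrableOn u (Ioo a b)) {s : ℝ}
    (hs : s ∈ T) : leftTrace u s = u s :=
  leftTrace_eq_of_continuousAt hui (hT.subset hs) (hT.continuousAt s hs)

/-- The limits of the values of `u` at the end points of intervals `]l n, r n]` which shrink to
`s`. -/
lemma tendsto_endpoints (hT : IsRegularSet a b B u T) (hu : BoundedVariationOn u (Ioo a b))
    (hui : IntegrableOn u (Ioo a b)) {s : ℝ} (hs : s ∈ Ioo a b) {l r : ℕ → ℝ}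
    (hl : ∀ n, l n ∈ T) (hr : ∀ n, r n ∈ T) (hlr : ∀ n, s ∈ Ioc (l n) (r n))
    (h0 : Tendsto (fun n => r n - l n) atTop (𝓝 0)) :
    Tendsto l atTop (𝓝[T ∩ Iio s] s) ∧ Tendsto (fun n => u (l n)) atTop (𝓝 (leftTrace u s)) ∧
      Tendsto (fun n => u (r n)) atTop (𝓝 (rightTrace u s)) := by
  have hls : Tendsto l atTop (𝓝 s) := by
    rw [tendsto_iff_dist_tendsto_zero]
    refine squeeze_zero (fun _ => dist_nonneg) (fun n => ?_) h0
    rw [Real.dist_eq, abs_sub_comm, abs_of_pos (sub_pos.2 (hlr n).1)]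
    linarith [(hlr n).2]
  have hrs : Tendsto r atTop (𝓝 s) := by
    rw [tendsto_iff_dist_tendsto_zero]
    refine squeeze_zero (fun _ => dist_nonneg) (fun n => ?_) h0
    rw [Real.dist_eq, abs_of_nonneg (sub_nonneg.2 (hlr n).2)]
    linarith [(hlr n).1]
  have hl' : Tendsto l atTop (𝓝[T ∩ Iio s] s) :=
    tendsto_nhdsWithin_iff.2 ⟨hls, Eventually.of_forall fun n => ⟨hl n, (hlr n).1⟩⟩
  refine ⟨hl', (BVChain.tendsto_leftTrace hu hui hs).comp
    (hl'.mono_right (nhdsWithin_mono _ inter_subset_right)), ?_⟩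
  by_cases hsT : s ∈ T
  · rw [hT.rightTrace_eq_self hui hsT]
    exact (hT.continuousAt s hsT).tendsto.comp hrs
  · refine (BVChain.tendsto_rightTrace hu hui hs).comp (tendsto_nhdsWithin_iff.2 ⟨hrs, ?_⟩)
    refine Eventually.of_forall fun n => lt_of_le_of_ne (hlr n).2 fun h => hsT ?_
    rw [h]; exact hr n

/-- The pointwise limit behind the increment formula. The points `ξ n` come from the mean value
theorem; at an atom they need not converge, but the scalar products do. -/
lemma tendsto_inner_gradient (hT : IsRegularSet a b B u T) (hu : BoundedVariationOn u (Ioo a b))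
    (hui : IntegrableOn u (Ioo a b)) {R : ℝ} (hR : ∀ s ∈ Ioo a b, ‖u s‖ ≤ R) {κ : Measure ℝ}
    [IsFiniteMeasure κ] {θ : ℝ → E}
    {s : ℝ} (hs : s ∈ Ioo a b) (hκ : κ.real {s} • θ s = rightTrace u s - leftTrace u s)
    (hs0 : s ∉ T → κ {s} ≠ 0) {l r : ℕ → ℝ}
    (hl : ∀ n, l n ∈ T) (hr : ∀ n, r n ∈ T) (hlr : ∀ n, s ∈ Ioc (l n) (r n))
    (h0 : Tendsto (fun n => r n - l n) atTop (𝓝 0)) {ξ : ℕ → E}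
    (hξ : ∀ n, ξ n ∈ segment ℝ (u (l n)) (u (r n)))
    (hmv : ∀ n, B (l n) (u (r n)) - B (l n) (u (l n)) =
      inner ℝ (gradient (B (l n)) (ξ n)) (u (r n) - u (l n))) :
    Tendsto (fun n => inner ℝ (gradient (B (l n)) (ξ n)) (θ s)) atTop
      (𝓝 (innerDensity B u T κ θ s)) := by
  obtain ⟨hls, hul, hur⟩ := hT.tendsto_endpoints hu hui hs hl hr hlr h0
  by_cases hsT : s ∈ T
  · rw [innerDensity, if_pos hsT]
    rw [hT.leftTrace_eq_self hui hsT] at hul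
    rw [hT.rightTrace_eq_self hui hsT] at hur
    have hξs : Tendsto ξ atTop (𝓝 (u s)) := by
      refine hul.congr_dist ?_
      have hz : Tendsto (fun n => ‖u (r n) - u (l n)‖) atTop (𝓝 0) := by
        have := (hur.sub hul).norm
        rwa [sub_self, norm_zero] at this
      refine squeeze_zero (fun _ => dist_nonneg) (fun n => ?_) hz
      rw [dist_comm, dist_eq_norm]
      exact norm_sub_le_of_mem_segment (hξ n)
    have hg := (hT.tendsto_gradient s hsT (u s)).comp
      ((hls.mono_right (nhdsWithin_mono _ inter_subset_left)).prodMk hξs)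
    exact hg.inner tendsto_const_nhds
  · rw [innerDensity, if_neg hsT]
    have hk : κ.real {s} ≠ 0 := by
      rw [measureReal_def, ENNReal.toReal_ne_zero]
      exact ⟨hs0 hsT, measure_ne_top _ _⟩
    have hθ : θ s = (κ.real {s})⁻¹ • (rightTrace u s - leftTrace u s) := by
      rw [← hκ, smul_smul, inv_mul_cancel₀ hk, one_smul]
    simp_rw [hθ, inner_smul_right]
    refine Tendsto.const_mul _ ?_
    have h1 : Tendsto (fun n => B (l n) (u (r n)) - B (l n) (u (l n))) atTop
        (𝓝 (leftTrace (fun x => B x (rightTrace u s)) s -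
          leftTrace (fun x => B x (leftTrace u s)) s)) :=
      ((hT.tendsto_leftTrace hs _).comp (hls.prodMk hur)).sub
        ((hT.tendsto_leftTrace hs _).comp (hls.prodMk hul))
    refine h1.congr_dist ?_
    obtain ⟨D, hD0, hD⟩ := hT.bound R
    have hz : Tendsto (fun n => D * ‖(rightTrace u s - leftTrace u s) - (u (r n) - u (l n))‖) atTop
        (𝓝 0) := by
      have := ((tendsto_const_nhds (x := rightTrace u s - leftTrace u s)).sub
        (hur.sub hul)).norm.const_mul D
      rwa [sub_self, norm_zero, mul_zero] at this
    refine squeeze_zero (fun _ => dist_nonneg) (fun n => ?_) hz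
    rw [hmv, dist_comm, Real.dist_eq, ← inner_sub_right]
    refine (abs_real_inner_le_norm _ _).trans (mul_le_mul_of_nonneg_right ?_ (norm_nonneg _))
    refine hD _ (hl n) _ ((convex_closedBall (0 : E) R).segment_subset ?_ ?_ (hξ n))
    · simpa using hR _ (hT.subset (hl n))
    · simpa using hR _ (hT.subset (hr n))

/-- The increments of `x ↦ B(x, u(x))` between regular points. Along partitions, each increment is
split into one in `x` and one in `w`, and the mesh tends to zero. -/
lemma comp_sub_comp (hT : IsRegularSet a b B u T) (hu : BoundedVariationOn u (Ioo a b))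
    (hui : IntegrableOn u (Ioo a b)) {R : ℝ} (hR : ∀ s ∈ Ioo a b, ‖u s‖ ≤ R)
    {m : Measure ℝ} {ρ : ℝ → E → ℝ} (hρc : ∀ x, Continuous (ρ x))
    (hρi : ∀ w, Integrable (fun x => ρ x w) m)
    (hρb : ∀ n : ℕ, ∃ c : ℝ → ℝ, Integrable c m ∧
      ∀ᵐ x ∂m, ∀ w ∈ Metric.closedBall (0 : E) n, |ρ x w| ≤ c x)
    (hρ : ∀ w, ∀ x ∈ T, ∀ y ∈ T, x ≤ y → ∫ s in Ioc x y, ρ s w ∂m = B y w - B x w)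
    {κ : Measure ℝ} [IsFiniteMeasure κ] {θ : ℝ → E} (hθi : Integrable θ κ)
    (hθ : ∀ x ∈ T, ∀ y ∈ T, x ≤ y → ∫ s in Ioc x y, θ s ∂κ = u y - u x)
    (hκ : ∀ s ∈ Ioo a b, κ.real {s} • θ s = rightTrace u s - leftTrace u s)
    {x y : ℝ} (hx : x ∈ T) (hy : y ∈ T) (hxy : x < y) :
    B y (u y) - B x (u x) = (∫ s in Ioc x y, ρ s (rightTrace u s) ∂m) +
      ∫ s in Ioc x y, innerDensity B u T κ θ s ∂κ := by
  obtain ⟨t, ht0, ht1, htm, htC, htI, htmesh⟩ := exists_partition hT.countable hxy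
    (fun h => h.2 hx) (fun h => h.2 hy)
  have hIcc : Icc x y ⊆ Ioo a b := fun z hz =>
    ⟨(hT.subset hx).1.trans_le hz.1, hz.2.trans_lt (hT.subset hy).2⟩
  have htT : ∀ n i, t n i ∈ T := fun n i => by
    by_contra h
    exact htC n i ⟨hIcc (htI n i), h⟩
  choose ξ hξ hmv using fun n i => exists_mem_segment_sub_eq_inner_gradient
    (hT.contDiff (t n i) (htT n i)) (u (t n i)) (u (t n (i + 1)))
  have hmesh : ∀ i : ℕ → ℕ, Tendsto (fun n => t n (i n + 1) - t n (i n)) atTop (𝓝 0) := by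
    intro i
    have := (tendsto_one_div_add_atTop_nhds_zero_nat (𝕜 := ℝ)).const_mul (2 * (y - x))
    rw [mul_zero] at this
    exact squeeze_zero (fun n => sub_nonneg.2 (htm n (Nat.le_succ _))) (fun n => htmesh n _) this
  obtain ⟨D, hD0, hD⟩ := hT.bound R
  obtain ⟨n₀, hn₀⟩ := exists_nat_ge R
  obtain ⟨c, hci, hc⟩ := hρb n₀
  -- the increments in `x`
  have lim1 : Tendsto (fun n => ∑ i ∈ Finset.range (n + 1),
      ∫ s in Ioc (t n i) (t n (i + 1)), ρ s (u (t n (i + 1))) ∂m) atTop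
      (𝓝 (∫ s in Ioc x y, ρ s (rightTrace u s) ∂m)) := by
    refine tendsto_sum_setIntegral_cells ht0 ht1 htm (h := fun n i s => ρ s (u (t n (i + 1))))
      (fun n i => hρi _) hci (fun n i => ?_) (Eventually.of_forall fun s hs i hi => ?_)
    · filter_upwards [hc] with s hs _
      refine hs _ ?_
      rw [mem_closedBall_zero_iff]
      exact (hR _ (hIcc (htI n _))).trans hn₀
    · exact ((hρc s).tendsto _).comp (hT.tendsto_endpoints hu hui (hIcc ⟨hs.1.le, hs.2⟩)
        (fun n => htT n _) (fun n => htT n _) hi (hmesh i)).2.2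
  -- the increments in `w`
  have lim2 : Tendsto (fun n => ∑ i ∈ Finset.range (n + 1),
      ∫ s in Ioc (t n i) (t n (i + 1)), inner ℝ (gradient (B (t n i)) (ξ n i)) (θ s) ∂κ) atTop
      (𝓝 (∫ s in Ioc x y, innerDensity B u T κ θ s ∂κ)) := by
    refine tendsto_sum_setIntegral_cells ht0 ht1 htm
      (h := fun n i s => inner ℝ (gradient (B (t n i)) (ξ n i)) (θ s)) (bound := fun s => D * ‖θ s‖)
      (fun n i => hθi.const_inner _) (hθi.norm.const_mul D)
      (fun n i => Eventually.of_forall fun s _ => ?_) ?_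
    · refine (abs_real_inner_le_norm _ _).trans (mul_le_mul_of_nonneg_right ?_ (norm_nonneg _))
      refine hD _ (htT n i) _ ((convex_closedBall (0 : E) R).segment_subset ?_ ?_ (hξ n i))
      · simpa using hR _ (hIcc (htI n i))
      · simpa using hR _ (hIcc (htI n (i + 1)))
    · -- the points off `T` which are not atoms of `κ` form a null set, since they are countably many
      have hnull : κ {s | s ∈ Ioo a b \ T ∧ κ {s} = 0} = 0 := by
        have hcount : {s | s ∈ Ioo a b \ T ∧ κ {s} = 0}.Countable :=
          hT.countable.mono fun s hs => hs.1
        rw [← biUnion_of_singleton {s | s ∈ Ioo a b \ T ∧ κ {s} = 0},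
          measure_biUnion_null_iff hcount]
        exact fun s hs => hs.2
      filter_upwards [measure_eq_zero_iff_ae_notMem.1 hnull] with s hsn hs i hi
      have hsab := hIcc ⟨hs.1.le, hs.2⟩
      exact hT.tendsto_inner_gradient hu hui hR hsab (hκ s hsab)
        (fun hsT h => hsn ⟨⟨hsab, hsT⟩, h⟩) (fun n => htT n _) (fun n => htT n _) hi (hmesh i)
        (fun n => hξ n _) (fun n => hmv n _)
  refine tendsto_nhds_unique (tendsto_const_nhds.congr fun n => ?_) (lim1.add lim2)
  rw [← Finset.sum_add_distrib]
  have htel := Finset.sum_range_sub (fun i => B (t n i) (u (t n i))) (n + 1)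
  simp only [ht0, ht1] at htel
  rw [← htel]
  refine Finset.sum_congr rfl fun i _ => ?_
  rw [hρ _ _ (htT n _) _ (htT n _) (htm n (Nat.le_succ i)), integral_inner hθi.integrableOn,
    hθ _ (htT n _) _ (htT n _) (htm n (Nat.le_succ i)), ← hmv]
  ring

end IsRegularSet

end Increment

/-! ### The base measure and the parts of a derivative -/

section BaseMeasure

variable {a b : ℝ} {lam ζ : Measure ℝ} {S : Set ℝ} {f h : ℝ → ℝ}

/-- A finite measure with atoms exactly at the points of a countable set `S`. -/
lemma exists_measure_atoms (hS : S.Countable) : ∃ ζ : Measure ℝ, IsFiniteMeasure ζ ∧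
    ∀ A, MeasurableSet A → (ζ A = 0 ↔ Disjoint A S) := by
  have := hS.to_subtype
  refine ⟨(Measure.sum fun x : S => Measure.dirac (x : ℝ)).toFinite, inferInstance,
    fun A hA => ?_⟩
  have h1 : (Measure.sum fun x : S => Measure.dirac (x : ℝ)).toFinite A = 0 ↔
      (Measure.sum fun x : S => Measure.dirac (x : ℝ)) A = 0 :=
    ⟨fun h => absolutelyContinuous_toFinite _ h, fun h => toFinite_absolutelyContinuous _ h⟩
  rw [h1, Measure.sum_apply _ hA, ENNReal.tsum_eq_zero, Set.disjoint_right]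
  simp [Measure.dirac_apply' _ hA]

/-- The measure with respect to which all derivatives have densities: Lebesgue measure on
`]a, b[`, a Cantor measure `lam`, and a measure `ζ` which will consist of atoms. -/
noncomputable def baseMeasure (a b : ℝ) (lam ζ : Measure ℝ) : Measure ℝ :=
  volume.restrict (Ioo a b) + lam + ζ

instance [IsFiniteMeasure lam] [IsFiniteMeasure ζ] : IsFiniteMeasure (baseMeasure a b lam ζ) := by
  have : IsFiniteMeasure (volume.restrict (Ioo a b)) := ⟨by simp⟩
  unfold baseMeasure; infer_instance

lemma baseMeasure_real_singleton [IsFiniteMeasure ζ] (hlam : IsCantorMeasure a b lam) (x : ℝ) :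
    (baseMeasure a b lam ζ).real {x} = ζ.real {x} := by
  simp only [measureReal_def, baseMeasure, Measure.add_apply, hlam.diffuse, add_zero]
  rw [Measure.restrict_apply (measurableSet_singleton x),
    measure_mono_null inter_subset_left Real.volume_singleton, zero_add]

lemma ae_mem_of_countable {m : Measure ℝ} (hm : ∀ x, m {x} = 0) (hI : m (Ioo a b)ᶜ = 0) {T : Set ℝ}
    (hc : (Ioo a b \ T).Countable) : ∀ᵐ x ∂m, x ∈ T := by
  have h1 : m (Ioo a b \ T) = 0 := by
    rw [← biUnion_of_singleton (Ioo a b \ T)]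
    exact (measure_biUnion_null_iff hc).2 fun x _ => hm x
  refine measure_mono_null (fun x (hx : x ∉ T) => ?_) (measure_union_null hI h1)
  by_cases hxI : x ∈ Ioo a b
  · exact Or.inr ⟨hxI, hx⟩
  · exact Or.inl hxI

lemma ae_restrict_Ioo_mem_of_countable {T : Set ℝ} (hc : (Ioo a b \ T).Countable) :
    ∀ᵐ x ∂volume.restrict (Ioo a b), x ∈ T := by
  refine ae_mem_of_countable (fun x => ?_) ?_ hc
  · rw [Measure.restrict_apply (measurableSet_singleton x)]
    exact measure_mono_null inter_subset_left Real.volume_singleton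
  · rw [Measure.restrict_apply measurableSet_Ioo.compl, compl_inter_self, measure_empty]

/-- On a set of regular points, which the atoms do not meet, the base measure is diffuse. -/
lemma baseMeasure_restrict (hlam : IsCantorMeasure a b lam)
    (hζ : ∀ A, MeasurableSet A → (ζ A = 0 ↔ Disjoint A S)) {T : Set ℝ} (hT : MeasurableSet T)
    (hc : (Ioo a b \ T).Countable) (hTS : Disjoint T S) :
    (baseMeasure a b lam ζ).restrict T = volume.restrict (Ioo a b) + lam := by
  rw [baseMeasure, Measure.restrict_add, Measure.restrict_add,
    Measure.restrict_eq_zero.2 ((hζ T hT).2 hTS), add_zero,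
    Measure.restrict_eq_self_of_ae_mem (ae_mem_of_countable hlam.diffuse hlam.carried hc),
    Measure.restrict_eq_self_of_ae_mem (ae_restrict_Ioo_mem_of_countable hc)]

lemma ae_mem_Ioo_baseMeasure (hlam : IsCantorMeasure a b lam) (hSI : S ⊆ Ioo a b)
    (hζ : ∀ A, MeasurableSet A → (ζ A = 0 ↔ Disjoint A S)) :
    ∀ᵐ x ∂baseMeasure a b lam ζ, x ∈ Ioo a b := by
  rw [baseMeasure, ae_add_measure_iff, ae_add_measure_iff]
  refine ⟨⟨ae_restrict_mem measurableSet_Ioo, hlam.carried⟩, ?_⟩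
  exact (hζ _ measurableSet_Ioo.compl).2 (disjoint_compl_left.mono_right hSI)

lemma singularPart_add_withDensity_apply (D : SignedMeasure ℝ) (A : Set ℝ) (hA : MeasurableSet A) :
    D A = D.singularPart volume A + ∫ x in A, D.rnDeriv volume x := by
  conv_lhs => rw [← D.singularPart_add_withDensity_rnDeriv_eq volume]
  rw [add_apply, withDensityᵥ_apply (SignedMeasure.integrable_rnDeriv _ _) hA]

lemma distribDeriv_inter_Ioo (hab : a < b) (hf : BoundedVariationOn f (Ioo a b))
    (hi : IntegrableOn f (Ioo a b)) {A : Set ℝ} (hA : MeasurableSet A) :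
    distribDeriv a b f (A ∩ Ioo a b) = distribDeriv a b f A := by
  conv_rhs => rw [← inter_union_sdiff A (Ioo a b)]
  rw [VectorMeasure.of_union (disjoint_sdiff_right.mono_left inter_subset_right)
    (hA.inter measurableSet_Ioo) (hA.diff measurableSet_Ioo),
    (distribDeriv_spec hab hf hi).1 _ (hA.diff measurableSet_Ioo) disjoint_sdiff_left, add_zero]

/-- A derivative whose jumps lie in `S` and whose Cantor part is absolutely continuous with respect to
`lam` is absolutely continuous with respect to the base measure with atoms at `S`. -/
lemma withDensity_rnDeriv_baseMeasure (hab : a < b) (hf : BoundedVariationOn f (Ioo a b))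
    (hi : IntegrableOn f (Ioo a b)) (hJ : jumpSet a b f ⊆ S) [IsFiniteMeasure lam]
    [IsFiniteMeasure ζ] (hJm : MeasurableSet (jumpSet a b f))
    (hζ : ∀ A, MeasurableSet A → (ζ A = 0 ↔ Disjoint A S))
    (hac : ∀ A, MeasurableSet A → lam A = 0 → cantorPart a b f A = 0) :
    (baseMeasure a b lam ζ).withDensityᵥ ((distribDeriv a b f).rnDeriv (baseMeasure a b lam ζ)) =
      distribDeriv a b f := by
  refine SignedMeasure.withDensityᵥ_rnDeriv_eq _ _ (VectorMeasure.AbsolutelyContinuous.mk ?_)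
  intro A hA h0
  rw [Measure.toENNRealVectorMeasure_apply_measurable hA, baseMeasure, Measure.add_apply,
    Measure.add_apply, add_eq_zero, add_eq_zero, hζ A hA, Measure.restrict_apply hA] at h0
  obtain ⟨⟨h1, h2⟩, h3⟩ := h0
  have hAI := hA.inter (measurableSet_Ioo (a := a) (b := b))
  have hI : MeasurableSet (Ioo a b \ jumpSet a b f) := measurableSet_Ioo.diff hJm
  have h5 := hac A hA h2
  rw [cantorPart, VectorMeasure.restrict_apply _ hI hA] at h5
  have h6 : A ∩ (Ioo a b \ jumpSet a b f) = A ∩ Ioo a b := by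
    ext x
    have : x ∈ A → x ∉ jumpSet a b f := fun hx hx' => Set.disjoint_left.1 h3 hx (hJ hx')
    simp only [mem_inter_iff, Set.mem_sdiff]
    tauto
  rw [h6] at h5
  rw [← distribDeriv_inter_Ioo hab hf hi hA, singularPart_add_withDensity_apply _ _ hAI, h5, Measure.restrict_eq_zero.2 h1]
  simp

/-- The part of a measure with density `h` with respect to the base measure that is singular to
Lebesgue measure. -/
lemma withDensity_mutuallySingular (hlam : IsCantorMeasure a b lam) (hS : S.Countable)
    (hζ : ∀ A, MeasurableSet A → (ζ A = 0 ↔ Disjoint A S)) {m : Measure ℝ} (hm : m ≪ volume) :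
    ((lam + ζ).withDensityᵥ h) ⟂ᵥ m.toENNRealVectorMeasure := by
  by_cases hh : Integrable h (lam + ζ)
  swap
  · rw [Measure.withDensityᵥ, dif_neg hh]; exact VectorMeasure.MutuallySingular.zero_left
  obtain ⟨s, hs, hs1, hs2⟩ := hlam.singular
  refine VectorMeasure.MutuallySingular.mk (s \ S) (hs.diff hS.measurableSet) ?_ ?_
  · intro t hts ht
    have h0 : (lam + ζ) t = 0 := by
      rw [Measure.add_apply, measure_mono_null (hts.trans sdiff_subset) hs1, zero_add, hζ t ht]
      exact Set.disjoint_left.2 fun x hx => (hts hx).2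
    rw [withDensityᵥ_apply hh ht, Measure.restrict_eq_zero.2 h0, integral_zero_measure]
  · intro t hts ht
    rw [Measure.toENNRealVectorMeasure_apply_measurable ht]
    refine hm (measure_mono_null (t := sᶜ ∪ S) (fun x hx => ?_) (measure_union_null hs2
      (hS.measure_zero _)))
    by_contra hc
    exact hts hx ⟨by_contra fun h' => hc (Or.inl h'), fun h' => hc (Or.inr h')⟩

lemma integrable_baseMeasure_iff : Integrable h (baseMeasure a b lam ζ) ↔
    (IntegrableOn h (Ioo a b) ∧ Integrable h lam) ∧ Integrable h ζ := by
  rw [baseMeasure, integrable_add_measure, integrable_add_measure, IntegrableOn]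

lemma withDensity_baseMeasure_apply (hh : Integrable h (baseMeasure a b lam ζ)) {A : Set ℝ}
    (hA : MeasurableSet A) : (baseMeasure a b lam ζ).withDensityᵥ h A =
      (∫ x in A ∩ Ioo a b, h x) + ((∫ x in A, h x ∂lam) + ∫ x in A, h x ∂ζ) := by
  obtain ⟨⟨h1, h2⟩, h3⟩ := integrable_baseMeasure_iff.1 hh
  rw [withDensityᵥ_apply hh hA, baseMeasure, Measure.restrict_add, Measure.restrict_add,
    integral_add_measure (Integrable.add_measure (Integrable.restrict h1) h2.restrict) h3.restrict,
    integral_add_measure (Integrable.restrict h1) h2.restrict, add_assoc,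
    Measure.restrict_restrict hA]

lemma withDensity_baseMeasure_eq (hh : Integrable h (baseMeasure a b lam ζ)) :
    (baseMeasure a b lam ζ).withDensityᵥ h =
      (lam + ζ).withDensityᵥ h + (volume.restrict (Ioo a b)).withDensityᵥ h ∧
    (baseMeasure a b lam ζ).withDensityᵥ h =
      (lam + ζ).withDensityᵥ h + volume.withDensityᵥ ((Ioo a b).indicator h) := by
  obtain ⟨⟨h1, h2⟩, h3⟩ := integrable_baseMeasure_iff.1 hh
  have h4 : ∀ A, MeasurableSet A → (lam + ζ).withDensityᵥ h A =
      (∫ x in A, h x ∂lam) + ∫ x in A, h x ∂ζ := by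
    intro A hA
    rw [withDensityᵥ_apply (h2.add_measure h3) hA, Measure.restrict_add,
      integral_add_measure h2.restrict h3.restrict]
  constructor
  · ext A hA
    rw [withDensity_baseMeasure_apply hh hA, add_apply, h4 A hA, withDensityᵥ_apply h1 hA,
      Measure.restrict_restrict hA, add_comm]
  · ext A hA
    rw [withDensity_baseMeasure_apply hh hA, add_apply, h4 A hA,
      withDensityᵥ_apply (h1.integrable_indicator measurableSet_Ioo) hA,
      setIntegral_indicator measurableSet_Ioo, add_comm]

lemma rnDeriv_restrict_ae_eq (hlam : IsCantorMeasure a b lam) (hS : S.Countable)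
    (hζ : ∀ A, MeasurableSet A → (ζ A = 0 ↔ Disjoint A S))
    (hh : Integrable h (baseMeasure a b lam ζ)) {D : SignedMeasure ℝ}
    (hD : (baseMeasure a b lam ζ).withDensityᵥ h = D) :
    h =ᵐ[volume.restrict (Ioo a b)] D.rnDeriv (volume.restrict (Ioo a b)) :=
  SignedMeasure.eq_rnDeriv _ h (integrable_baseMeasure_iff.1 hh).1.1
    (withDensity_mutuallySingular hlam hS hζ Measure.restrict_le_self.absolutelyContinuous)
    (hD ▸ (withDensity_baseMeasure_eq hh).1)

lemma rnDeriv_volume_ae_eq (hlam : IsCantorMeasure a b lam) (hS : S.Countable)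
    (hζ : ∀ A, MeasurableSet A → (ζ A = 0 ↔ Disjoint A S))
    (hh : Integrable h (baseMeasure a b lam ζ)) {D : SignedMeasure ℝ}
    (hD : (baseMeasure a b lam ζ).withDensityᵥ h = D) :
    h =ᵐ[volume.restrict (Ioo a b)] D.rnDeriv volume := by
  have h1 := SignedMeasure.eq_rnDeriv _ ((Ioo a b).indicator h)
    ((integrable_baseMeasure_iff.1 hh).1.1.integrable_indicator measurableSet_Ioo)
    (withDensity_mutuallySingular hlam hS hζ Measure.AbsolutelyContinuous.rfl)
    (hD ▸ (withDensity_baseMeasure_eq hh).2)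
  exact (indicator_ae_eq_restrict measurableSet_Ioo).symm.trans (ae_restrict_of_ae h1)

/-- The Cantor part of a derivative with density `h` with respect to the base measure: at the atoms
of `ζ` which are not jump points, `h` vanishes. -/
lemma cantorPart_eq_withDensity (hab : a < b) (hf : BoundedVariationOn f (Ioo a b))
    (hi : IntegrableOn f (Ioo a b)) (hJ : jumpSet a b f ⊆ S) [IsFiniteMeasure ζ]
    (hlam : IsCantorMeasure a b lam) (hS : S.Countable)
    (hζ : ∀ A, MeasurableSet A → (ζ A = 0 ↔ Disjoint A S))
    (hh : Integrable h (baseMeasure a b lam ζ))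
    (hD : (baseMeasure a b lam ζ).withDensityᵥ h = distribDeriv a b f) :
    cantorPart a b f = lam.withDensityᵥ h := by
  have hlf := hlam.finite
  obtain ⟨⟨h1, h2⟩, h3⟩ := integrable_baseMeasure_iff.1 hh
  have hJm : MeasurableSet (jumpSet a b f) := (hS.mono hJ).measurableSet
  have hI : MeasurableSet (Ioo a b \ jumpSet a b f) := measurableSet_Ioo.diff hJm
  -- at a point `x` which is not a jump point, `0 = Df {x} = ζ {x} * h x`
  have hz : ∀ᵐ x ∂ζ, x ∈ Ioo a b \ jumpSet a b f → h x = 0 := by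
    have hS' : ∀ᵐ x ∂ζ, x ∈ S := (hζ _ hS.measurableSet.compl).2 disjoint_compl_left
    have hc : ζ {x | x ∈ S ∧ ¬(x ∈ Ioo a b \ jumpSet a b f → h x = 0)} = 0 := by
      have hcc : {x | x ∈ S ∧ ¬(x ∈ Ioo a b \ jumpSet a b f → h x = 0)}.Countable :=
        hS.mono fun x hx => hx.1
      rw [← biUnion_of_singleton {x | x ∈ S ∧ ¬(x ∈ Ioo a b \ jumpSet a b f → h x = 0)}]
      refine (measure_biUnion_null_iff hcc).2 fun x hx => ?_
      obtain ⟨_, hx⟩ := hx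
      rw [Classical.not_imp] at hx
      have h4 := (distribDeriv_spec hab hf hi).2.2 x hx.1.1
      have h5 : leftTrace f x = rightTrace f x := by
        by_contra h'; exact hx.1.2 ⟨hx.1.1, h'⟩
      rw [← hD, withDensityᵥ_apply hh (measurableSet_singleton x), integral_singleton,
        baseMeasure_real_singleton hlam, h5, sub_self, smul_eq_zero] at h4
      exact (measureReal_eq_zero_iff).1 (h4.resolve_right hx.2)
    filter_upwards [hS', compl_mem_ae_iff.2 hc] with x hx hx' hxI
    by_contra h0
    exact hx' ⟨hx, fun h' => h0 (h' hxI)⟩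
  have hl : ∀ᵐ x ∂lam, x ∈ Ioo a b \ jumpSet a b f := by
    have h6 : lam (jumpSet a b f) = 0 := by
      rw [← biUnion_of_singleton (jumpSet a b f)]
      exact (measure_biUnion_null_iff (hS.mono hJ)).2 fun x _ => hlam.diffuse x
    filter_upwards [compl_mem_ae_iff.2 h6, (hlam.carried : ∀ᵐ x ∂lam, x ∈ Ioo a b)] with x hx hx'
    exact ⟨hx', hx⟩
  have hsing := SignedMeasure.eq_singularPart _ ((Ioo a b).indicator h)
    (withDensity_mutuallySingular hlam hS hζ Measure.AbsolutelyContinuous.rfl)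
    (hD ▸ (withDensity_baseMeasure_eq hh).2)
  ext A hA
  have hAI := hA.inter hI
  rw [cantorPart, ← hsing, VectorMeasure.restrict_apply _ hI hA,
    withDensityᵥ_apply (h2.add_measure h3) hAI, Measure.restrict_add,
    integral_add_measure h2.restrict h3.restrict, withDensityᵥ_apply h2 hA]
  have h7 : ∫ x in A ∩ (Ioo a b \ jumpSet a b f), h x ∂ζ = 0 := by
    refine integral_eq_zero_of_ae ((ae_restrict_iff' hAI).2 ?_)
    filter_upwards [hz] with x hx hx' using hx hx'.2
  rw [h7, add_zero]
  refine setIntegral_congr_set ?_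
  filter_upwards [hl] with x hx
  exact propext ⟨fun h' => h'.1, fun h' => ⟨h', hx⟩⟩

/-- The Cantor part has no atoms, and is singular to Lebesgue measure. -/
lemma isCantorMeasure_variation_cantorPart (hab : a < b) (hf : BoundedVariationOn f (Ioo a b))
    (hi : IntegrableOn f (Ioo a b)) (hJm : MeasurableSet (jumpSet a b f)) :
    IsCantorMeasure a b (cantorPart a b f).variation := by
  have hI : MeasurableSet (Ioo a b \ jumpSet a b f) := measurableSet_Ioo.diff hJm
  refine ⟨?_, ?_, fun x => ?_, ?_⟩
  · rw [← SignedMeasure.totalVariation_eq_variation]; infer_instance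
  · rw [cantorPart, VectorMeasure.variation_restrict hI,
      Measure.restrict_apply measurableSet_Ioo.compl]
    rw [(disjoint_compl_left.mono_right sdiff_subset).inter_eq, measure_empty]
  · rw [VectorMeasure.variation_apply_eq_zero (measurableSet_singleton x)]
    intro t ht htm
    rcases subset_singleton_iff_eq.1 ht with rfl | rfl
    · simp
    rw [cantorPart, VectorMeasure.restrict_apply _ hI htm]
    by_cases hx : x ∈ Ioo a b \ jumpSet a b f
    · rw [inter_eq_self_of_subset_left (singleton_subset_iff.2 hx)]
      have h1 := singularPart_add_withDensity_apply (distribDeriv a b f) {x} htm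
      rw [(distribDeriv_spec hab hf hi).2.2 x hx.1, Measure.restrict_eq_zero.2
        Real.volume_singleton, integral_zero_measure, add_zero] at h1
      rw [← h1, sub_eq_zero]
      by_contra h'
      exact hx.2 ⟨hx.1, fun h => h' h.symm⟩
    · rw [singleton_inter_eq_empty.2 hx, VectorMeasure.empty]
  · rw [cantorPart, VectorMeasure.variation_restrict hI]
    have h1 := SignedMeasure.mutuallySingular_singularPart (distribDeriv a b f) volume
    rw [SignedMeasure.mutuallySingular_ennreal_iff,
      SignedMeasure.totalVariation_eq_variation] at h1
    have h2 : volume.toENNRealVectorMeasure.ennrealToMeasure = (volume : Measure ℝ) :=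
      VectorMeasure.ennrealToMeasure_toENNRealVectorMeasure _
    exact (h2 ▸ h1).mono Measure.restrict_le_self le_rfl

end BaseMeasure

/-! ### Common densities -/

section CommonDensity

variable {a b : ℝ}

/-- All the derivatives `Dₓ B(·, w)` have densities with respect to one base measure, in a version
which is continuous in `w`. -/
lemma exists_density_family {E : Type*} [NormedAddCommGroup E] [TopologicalSpace.SeparableSpace E]
    {B : ℝ → E → ℝ} {N : Set ℝ} {lam ζ : Measure ℝ} (hab : a < b) (hN : N.Countable)
    (hBV : ∀ w, BoundedVariationOn (fun x => B x w) (Ioo a b))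
    (hBi : ∀ w, IntegrableOn (fun x => B x w) (Ioo a b))
    (hJ : ∀ w, jumpSet a b (fun x => B x w) ⊆ N)
    {μ : ℕ → Measure ℝ} [∀ n, IsFiniteMeasure (μ n)]
    (hμ : ∀ n : ℕ, ∀ w ∈ Metric.closedBall (0 : E) n, ∀ w' ∈ Metric.closedBall (0 : E) n,
      ∀ A, MeasurableSet A → A ⊆ Ioo a b →
        |distribDeriv a b (fun x => B x w) A - distribDeriv a b (fun x => B x w') A| ≤
          ‖w - w'‖ * (μ n).real A)
    (hlam : IsCantorMeasure a b lam) [IsFiniteMeasure ζ]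
    (hac : ∀ w, ∀ A : Set ℝ, MeasurableSet A → lam A = 0 →
      cantorPart a b (fun x => B x w) A = 0)
    (hζ : ∀ A, MeasurableSet A → (ζ A = 0 ↔ Disjoint A N)) :
    ∃ ρ : ℝ → E → ℝ, (∀ x, Continuous (ρ x)) ∧ (∀ w, Measurable fun x => ρ x w) ∧
      (∀ w, Integrable (fun x => ρ x w) (baseMeasure a b lam ζ)) ∧
      (∀ n : ℕ, ∃ c : ℝ → ℝ, Integrable c (baseMeasure a b lam ζ) ∧
        ∀ᵐ x ∂baseMeasure a b lam ζ, ∀ w ∈ Metric.closedBall (0 : E) n, |ρ x w| ≤ c x) ∧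
      ∀ w, (baseMeasure a b lam ζ).withDensityᵥ (fun x => ρ x w) =
        distribDeriv a b (fun x => B x w) := by
  have := hlam.finite
  set m := baseMeasure a b lam ζ with hm
  let r : E → ℝ → ℝ := fun w => (distribDeriv a b (fun x => B x w)).rnDeriv m
  have hri : ∀ w, Integrable (r w) m := fun w => SignedMeasure.integrable_rnDeriv _ _
  have hr : ∀ w, m.withDensityᵥ (r w) = distribDeriv a b (fun x => B x w) := fun w =>
    withDensity_rnDeriv_baseMeasure hab (hBV w) (hBi w) (hJ w) (hN.mono (hJ w)).measurableSet hζ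
      (hac w)
  obtain ⟨ρ, h1, h2, h3, h4⟩ := exists_continuous_version (m := m) (r := r)
    (fun w => SignedMeasure.measurable_rnDeriv _ _) (hri 0) fun n =>
      ⟨fun x => ((μ n).rnDeriv m x).toReal, ((μ n).measurable_rnDeriv m).ennreal_toReal,
        Measure.integrable_toReal_rnDeriv, fun x => ENNReal.toReal_nonneg, fun w hw w' hw' => by
          simp_rw [mul_comm _ ‖w - w'‖]
          refine ae_abs_le_of_forall_setIntegral_le ((hri w).sub (hri w')) (μ n) fun A hA => ?_
          have h5 := hμ n w hw w' hw' _ (hA.inter measurableSet_Ioo) inter_subset_right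
          rw [distribDeriv_inter_Ioo hab (hBV w) (hBi w) hA,
            distribDeriv_inter_Ioo hab (hBV w') (hBi w') hA, ← hr w, ← hr w',
            withDensityᵥ_apply (hri w) hA, withDensityᵥ_apply (hri w') hA,
            ← integral_sub (hri w).restrict (hri w').restrict] at h5
          refine h5.trans ?_
          gcongr
          exacts [measure_ne_top _ _, inter_subset_left]⟩
  exact ⟨ρ, h1, h2, fun w => (hri w).congr (h3 w).symm, h4, fun w => by
    rw [← hr w]; exact WithDensityᵥEq.congr_ae (h3 w)⟩

/-- The sum of the total variations of the Cantor parts of finitely many derivatives is a Cantor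
measure which dominates them. -/
lemma exists_isCantorMeasure {ι : Type*} [Fintype ι] {f : ι → ℝ → ℝ} (hab : a < b)
    (hf : ∀ i, BoundedVariationOn (f i) (Ioo a b)) (hi : ∀ i, IntegrableOn (f i) (Ioo a b))
    (hJ : ∀ i, (jumpSet a b (f i)).Countable) :
    ∃ lam, IsCantorMeasure a b lam ∧ ∀ i A, MeasurableSet A → lam A = 0 →
      cantorPart a b (f i) A = 0 := by
  have h := fun i => isCantorMeasure_variation_cantorPart hab (hf i) (hi i) (hJ i).measurableSet
  have := fun i => (h i).finite
  refine ⟨∑ i, (cantorPart a b (f i)).variation, ⟨inferInstance, ?_, fun x => ?_, ?_⟩,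
    fun i A hA h0 => ?_⟩
  · rw [Measure.finsetSum_apply]
    exact Finset.sum_eq_zero fun i _ => (h i).carried
  · rw [Measure.finsetSum_apply]
    exact Finset.sum_eq_zero fun i _ => (h i).diffuse x
  · rw [← Measure.sum_fintype]
    exact Measure.MutuallySingular.sum_left.2 fun i => (h i).singular
  · rw [Measure.finsetSum_apply, Finset.sum_eq_zero_iff] at h0
    exact (VectorMeasure.variation_apply_eq_zero hA).1 (h0 i (Finset.mem_univ i)) A le_rfl hA

section Coordinates

variable {d : ℕ} {u : ℝ → EuclideanSpace ℝ (Fin d)}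

lemma boundedVariationOn_coord (hu : BoundedVariationOn u (Ioo a b)) (i : Fin d) :
    BoundedVariationOn (fun x => u x i) (Ioo a b) :=
  ((EuclideanSpace.proj i : EuclideanSpace ℝ (Fin d) →L[ℝ] ℝ).lipschitz.lipschitzOnWith
    (s := univ)).comp_boundedVariationOn (mapsTo_univ _ _) hu

lemma integrableOn_coord (hu : IntegrableOn u (Ioo a b)) (i : Fin d) :
    IntegrableOn (fun x => u x i) (Ioo a b) :=
  (EuclideanSpace.proj i : EuclideanSpace ℝ (Fin d) →L[ℝ] ℝ).integrable_comp hu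

lemma rightTrace_coord (hu : BoundedVariationOn u (Ioo a b)) (hui : IntegrableOn u (Ioo a b))
    {x : ℝ} (hx : x ∈ Ioo a b) (i : Fin d) : rightTrace (fun y => u y i) x = rightTrace u x i :=
  rightTrace_eq_of_tendsto (integrableOn_coord hui i) hx
    (((EuclideanSpace.proj i : EuclideanSpace ℝ (Fin d) →L[ℝ] ℝ).continuous.tendsto _).comp
      (tendsto_rightTrace hu hui hx))

lemma leftTrace_coord (hu : BoundedVariationOn u (Ioo a b)) (hui : IntegrableOn u (Ioo a b))
    {x : ℝ} (hx : x ∈ Ioo a b) (i : Fin d) : leftTrace (fun y => u y i) x = leftTrace u x i :=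
  leftTrace_eq_of_tendsto (integrableOn_coord hui i) hx
    (((EuclideanSpace.proj i : EuclideanSpace ℝ (Fin d) →L[ℝ] ℝ).continuous.tendsto _).comp
      (tendsto_leftTrace hu hui hx))

/-- A common density of the derivatives of the coordinates of `u`. The atoms may sit at any countable
set `S` which contains the jump points. -/
lemma exists_density_coord {S : Set ℝ} {ζ : Measure ℝ} [IsFiniteMeasure ζ] (hab : a < b)
    (hu : BoundedVariationOn u (Ioo a b)) (hui : IntegrableOn u (Ioo a b)) (hS : S.Countable)
    (hJ : jumpSet a b u ⊆ S) (hζ : ∀ A, MeasurableSet A → (ζ A = 0 ↔ Disjoint A S)) :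
    ∃ (lam : Measure ℝ) (θ : ℝ → EuclideanSpace ℝ (Fin d)), IsCantorMeasure a b lam ∧ Measurable θ ∧
      Integrable θ (baseMeasure a b lam ζ) ∧
      (∀ i, jumpSet a b (fun x => u x i) ⊆ S) ∧
      (∀ i, (baseMeasure a b lam ζ).withDensityᵥ (fun x => θ x i) =
        distribDeriv a b (fun x => u x i)) ∧
      (∀ x ∈ Ioo a b, ∀ y ∈ Ioo a b, x ≤ y →
        ∫ s in Ioc x y, θ s ∂baseMeasure a b lam ζ = rightTrace u y - rightTrace u x) ∧
      ∀ s ∈ Ioo a b, (baseMeasure a b lam ζ).real {s} • θ s = rightTrace u s - leftTrace u s := by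
  have hJi : ∀ i, jumpSet a b (fun x => u x i) ⊆ S := by
    refine fun i x hx => hJ ⟨hx.1, fun h => hx.2 ?_⟩
    rw [rightTrace_coord hu hui hx.1, leftTrace_coord hu hui hx.1, h]
  obtain ⟨lam, hlam, hac⟩ := exists_isCantorMeasure hab (boundedVariationOn_coord hu)
    (integrableOn_coord hui) fun i => hS.mono (hJi i)
  have := hlam.finite
  set κ := baseMeasure a b lam ζ with hκ
  let t : Fin d → ℝ → ℝ := fun i => (distribDeriv a b (fun x => u x i)).rnDeriv κ
  have hti : ∀ i, Integrable (t i) κ := fun i => SignedMeasure.integrable_rnDeriv _ _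
  have ht : ∀ i, κ.withDensityᵥ (t i) = distribDeriv a b (fun x => u x i) := fun i =>
    withDensity_rnDeriv_baseMeasure hab (boundedVariationOn_coord hu i) (integrableOn_coord hui i)
      (hJi i) (hS.mono (hJi i)).measurableSet hζ (hac i)
  have hθm : Measurable fun x => (WithLp.toLp 2 fun i => t i x : EuclideanSpace ℝ (Fin d)) :=
    (WithLp.measurable_toLp 2 _).comp
      (measurable_pi_lambda _ fun i => SignedMeasure.measurable_rnDeriv _ _)
  have hθi : Integrable (fun x => (WithLp.toLp 2 fun i => t i x : EuclideanSpace ℝ (Fin d))) κ := by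
    refine (integrable_finsetSum Finset.univ fun i _ => (hti i).norm).mono'
      hθm.aestronglyMeasurable (Eventually.of_forall fun x => ?_)
    rw [EuclideanSpace.norm_eq]
    simp only
    refine Real.sqrt_le_iff.2 ⟨Finset.sum_nonneg fun _ _ => norm_nonneg _, ?_⟩
    exact Finset.sum_sq_le_sq_sum_of_nonneg fun _ _ => norm_nonneg _
  refine ⟨lam, _, hlam, hθm, hθi, hJi, ht, fun x hx y hy hxy => ?_, fun s hs => ?_⟩
  · ext i
    have h1 := (EuclideanSpace.proj i : EuclideanSpace ℝ (Fin d) →L[ℝ] ℝ).integral_comp_comm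
      (hθi.restrict (s := Ioc x y))
    have h2 := (distribDeriv_spec hab (boundedVariationOn_coord hu i)
      (integrableOn_coord hui i)).2.1 x hx y hy hxy
    rw [← ht i, withDensityᵥ_apply (hti i) measurableSet_Ioc, rightTrace_coord hu hui hx,
      rightTrace_coord hu hui hy] at h2
    exact h1.symm.trans h2
  · ext i
    have h2 := (distribDeriv_spec hab (boundedVariationOn_coord hu i)
      (integrableOn_coord hui i)).2.2 s hs
    rw [← ht i, withDensityᵥ_apply (hti i) (measurableSet_singleton s), rightTrace_coord hu hui hs,
      leftTrace_coord hu hui hs, integral_singleton] at h2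
    exact h2

end Coordinates

end CommonDensity

/-! ### Variation of the composition and the formula on the regular set -/

lemma exists_norm_le_of_boundedVariationOn {F : Type*} [NormedAddCommGroup F] {u : ℝ → F} {a b : ℝ}
    (hu : BoundedVariationOn u (Ioo a b)) :
    ∃ R, ∀ s ∈ Ioo a b, ‖u s‖ ≤ R := by
  rcases (Ioo a b).eq_empty_or_nonempty with h | ⟨x, hx⟩
  · exact ⟨0, fun s hs => by simp [h] at hs⟩
  refine ⟨‖u x‖ + (eVariationOn u (Ioo a b)).toReal, fun s hs => ?_⟩
  have h1 := hu.dist_le hs hx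
  rw [dist_eq_norm] at h1
  linarith [norm_le_norm_add_norm_sub' (u s) (u x)]

section Composition

variable {E : Type*} [NormedAddCommGroup E] [InnerProductSpace ℝ E] [FiniteDimensional ℝ E]
  {a b : ℝ} {B : ℝ → E → ℝ} {u : ℝ → E} {T : Set ℝ}

/-- A function which is continuous along a subset of `]a, b[` with countable complement is Borel on
`]a, b[`. -/
lemma measurable_indicator_of_continuousOn {F : Type*} [NormedAddCommGroup F] [MeasurableSpace F]
    [BorelSpace F] {f : ℝ → F} (hT : MeasurableSet T) (hc : (Ioo a b \ T).Countable)
    (hTI : T ⊆ Ioo a b) (hf : ContinuousOn f T) : Measurable ((Ioo a b).indicator f) := by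
  classical
  have h1 : Measurable (T.piecewise f fun _ => 0) := hf.measurable_piecewise continuousOn_const hT
  refine h1.measurable_of_countable_ne (hc.mono fun x hx => ?_)
  by_contra h
  refine hx ?_
  by_cases hxI : x ∈ Ioo a b
  · have hxT : x ∈ T := by_contra fun h' => h ⟨hxI, h'⟩
    rw [piecewise_eq_of_mem _ _ _ hxT, indicator_of_mem hxI]
  · rw [piecewise_eq_of_notMem _ _ _ fun h' => hxI (hTI h'), indicator_of_notMem hxI]

namespace IsRegularSet

lemma sdiff_sdiff (hT : IsRegularSet a b B u T) : Ioo a b \ (Ioo a b \ T) = T := by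
  rw [sdiff_sdiff_right_self]; exact inter_eq_self_of_subset_right hT.subset

lemma continuousOn (hT : IsRegularSet a b B u T) : ContinuousOn u T := fun s hs =>
  (hT.continuousAt s hs).continuousWithinAt

lemma continuousOn_gradient (hT : IsRegularSet a b B u T) :
    ContinuousOn (fun s => gradient (B s) (u s)) T := fun s hs =>
  (hT.tendsto_gradient s hs (u s)).comp (tendsto_id.prodMk (hT.continuousOn s hs))

lemma continuousAt_section (hT : IsRegularSet a b B u T) {s : ℝ} (hs : s ∈ T) (w : E) :
    ContinuousAt (fun x => B x w) s := by
  rw [continuousAt_iff_continuous_left'_right']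
  constructor
  · have := BVChain.tendsto_leftTrace (hT.boundedVariationOn w) (hT.integrableOn w) (hT.subset hs)
    rwa [hT.leftTrace_eq s hs] at this
  · have := tendsto_rightTrace (hT.boundedVariationOn w) (hT.integrableOn w) (hT.subset hs)
    rwa [hT.rightTrace_eq s hs] at this

lemma continuousOn_comp (hT : IsRegularSet a b B u T) {R : ℝ} (hR : ∀ s ∈ Ioo a b, ‖u s‖ ≤ R) :
    ContinuousOn (fun s => B s (u s)) T := by
  obtain ⟨D, hD0, hD⟩ := hT.abs_sub_le R
  have hball : ∀ s ∈ T, u s ∈ Metric.closedBall (0 : E) R := fun s hs => by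
    simpa using hR s (hT.subset hs)
  intro s hs
  have h1 : Tendsto (fun x => B x (u s)) (𝓝[T] s) (𝓝 (B s (u s))) :=
    (hT.continuousAt_section hs (u s)).mono_left nhdsWithin_le_nhds
  refine h1.congr_dist ?_
  have h2 : Tendsto (fun x => D * ‖u s - u x‖) (𝓝[T] s) (𝓝 0) := by
    have := ((continuousWithinAt_const (b := u s)).sub (hT.continuousOn s hs)).norm.const_mul D
    simpa using this.tendsto
  refine squeeze_zero' (Eventually.of_forall fun _ => dist_nonneg) ?_ h2
  filter_upwards [self_mem_nhdsWithin] with x hx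
  exact hD x hx _ (hball s hs) _ (hball x hx)

/-- The left limits `B(s₋, ·)` inherit the Lipschitz estimates of `B(t, ·)` at regular points `t`. -/
lemma abs_leftTrace_sub_le (hT : IsRegularSet a b B u T) (R : ℝ) : ∃ D, 0 ≤ D ∧ ∀ s ∈ Ioo a b,
    ∀ w ∈ Metric.closedBall (0 : E) R, ∀ w' ∈ Metric.closedBall (0 : E) R,
      |leftTrace (fun x => B x w) s - leftTrace (fun x => B x w') s| ≤ D * ‖w - w'‖ := by
  obtain ⟨D, hD0, hD⟩ := hT.abs_sub_le R
  refine ⟨D, hD0, fun s hs w hw w' hw' => ?_⟩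
  have hne := neBot_nhdsLT_diff hT.countable hs
  rw [hT.sdiff_sdiff] at hne
  have hl : ∀ w, Tendsto (fun x => B x w) (𝓝[Iio s ∩ T] s) (𝓝 (leftTrace (fun x => B x w) s)) :=
    fun w => (BVChain.tendsto_leftTrace (hT.boundedVariationOn w) (hT.integrableOn w) hs).mono_left
      (nhdsWithin_mono _ inter_subset_left)
  refine le_of_tendsto ((hl w).sub (hl w')).abs ?_
  filter_upwards [self_mem_nhdsWithin] with x hx using hD x hx.2 w hw w' hw'

end IsRegularSet

lemma norm_rightTrace_le (hu : BoundedVariationOn u (Ioo a b)) (hui : IntegrableOn u (Ioo a b))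
    {R : ℝ} (hR : ∀ s ∈ Ioo a b, ‖u s‖ ≤ R) {s : ℝ} (hs : s ∈ Ioo a b) : ‖rightTrace u s‖ ≤ R := by
  refine le_of_tendsto (tendsto_rightTrace hu hui hs).norm ?_
  filter_upwards [Ioo_mem_nhdsGT hs.2] with x hx using hR x ⟨hs.1.trans hx.1, hx.2⟩

lemma norm_leftTrace_le (hu : BoundedVariationOn u (Ioo a b)) (hui : IntegrableOn u (Ioo a b))
    {R : ℝ} (hR : ∀ s ∈ Ioo a b, ‖u s‖ ≤ R) {s : ℝ} (hs : s ∈ Ioo a b) : ‖leftTrace u s‖ ≤ R := by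
  refine le_of_tendsto (tendsto_leftTrace hu hui hs).norm ?_
  filter_upwards [Ioo_mem_nhdsLT hs.1] with x hx using hR x ⟨hx.1, hx.2.trans hs.2⟩

/-- Densities `ρ(·, w)` of `Dₓ B(·, w)` with respect to `m`, continuous in `w` and locally bounded in
`w` by integrable functions, and a density `θ` of `Du` with respect to `κ`. -/
structure HasDensities (a b : ℝ) (B : ℝ → E → ℝ) (u : ℝ → E) (m κ : Measure ℝ) (ρ : ℝ → E → ℝ)
    (θ : ℝ → E) : Prop where
  boundedVariationOn : BoundedVariationOn u (Ioo a b)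
  integrableOn : IntegrableOn u (Ioo a b)
  outer_mem : ∀ᵐ x ∂m, x ∈ Ioo a b
  outer_continuous : ∀ x, Continuous (ρ x)
  outer_integrable : ∀ w, Integrable (fun x => ρ x w) m
  outer_measurable : ∀ w, Measurable fun x => ρ x w
  outer_bound : ∀ n : ℕ, ∃ c : ℝ → ℝ, Integrable c m ∧
    ∀ᵐ x ∂m, ∀ w ∈ Metric.closedBall (0 : E) n, |ρ x w| ≤ c x
  outer_Ioc : ∀ w, ∀ x ∈ Ioo a b, ∀ y ∈ Ioo a b, x ≤ y → ∫ s in Ioc x y, ρ s w ∂m =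
    rightTrace (fun x => B x w) y - rightTrace (fun x => B x w) x
  outer_singleton : ∀ w, ∀ s ∈ Ioo a b, m.real {s} * ρ s w =
    rightTrace (fun x => B x w) s - leftTrace (fun x => B x w) s
  inner_mem : ∀ᵐ x ∂κ, x ∈ Ioo a b
  inner_measurable : StronglyMeasurable θ
  inner_integrable : Integrable θ κ
  inner_Ioc : ∀ x ∈ Ioo a b, ∀ y ∈ Ioo a b, x ≤ y →
    ∫ s in Ioc x y, θ s ∂κ = rightTrace u y - rightTrace u x
  inner_singleton : ∀ s ∈ Ioo a b, κ.real {s} • θ s = rightTrace u s - leftTrace u s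

namespace HasDensities

variable {m κ : Measure ℝ} {ρ : ℝ → E → ℝ} {θ : ℝ → E}

lemma integrable_outer (h : HasDensities a b B u m κ ρ θ) (hT : IsRegularSet a b B u T) :
    Integrable (fun s => ρ s (rightTrace u s)) m := by
  borelize E
  obtain ⟨R, hR⟩ := exists_norm_le_of_boundedVariationOn h.boundedVariationOn
  obtain ⟨n, hn⟩ := exists_nat_ge R
  obtain ⟨c, hc, hcb⟩ := h.outer_bound n
  refine hc.mono' ?_ ?_
  · have h1 : Measurable ((Ioo a b).indicator (rightTrace u)) :=
      measurable_indicator_of_continuousOn hT.measurableSet hT.countable hT.subset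
        (hT.continuousOn.congr fun s hs => hT.rightTrace_eq_self h.integrableOn hs)
    have h2 : Measurable (Function.uncurry fun (w : E) (x : ℝ) => ρ x w) :=
      measurable_uncurry_of_continuous_of_measurable h.outer_continuous h.outer_measurable
    have h3 := h2.comp (h1.prodMk measurable_id)
    refine h3.aestronglyMeasurable.congr ?_
    filter_upwards [h.outer_mem] with x hx
    simp [Function.uncurry, indicator_of_mem hx]
  · filter_upwards [h.outer_mem, hcb] with x hx hx'
    refine hx' _ ?_
    rw [mem_closedBall_zero_iff]
    exact (norm_rightTrace_le h.boundedVariationOn h.integrableOn hR hx).trans hn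

/-- The inner density is bounded by a multiple of `‖θ‖`: at an atom of `κ` off the regular set this is the
Lipschitz estimate for `B(s₋, ·)`, and elsewhere off the regular set it has the value `0`. -/
lemma integrable_inner (h : HasDensities a b B u m κ ρ θ) (hT : IsRegularSet a b B u T) :
    Integrable (innerDensity B u T κ θ) κ := by
  borelize E
  obtain ⟨R, hR⟩ := exists_norm_le_of_boundedVariationOn h.boundedVariationOn
  obtain ⟨D, hD0, hD⟩ := hT.bound R
  obtain ⟨D', hD'0, hD'⟩ := hT.abs_leftTrace_sub_le R
  refine (h.inner_integrable.norm.const_mul (max D D')).mono' ?_ ?_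
  · have h1 : Measurable ((Ioo a b).indicator fun s => gradient (B s) (u s)) :=
      measurable_indicator_of_continuousOn hT.measurableSet hT.countable hT.subset
        hT.continuousOn_gradient
    have h2 : Measurable fun s => inner ℝ ((Ioo a b).indicator (fun s => gradient (B s) (u s)) s)
        (θ s) := h1.inner h.inner_measurable.measurable
    have h3 : Measurable ((Ioo a b).indicator (innerDensity B u T κ θ)) := by
      refine h2.measurable_of_countable_ne (hT.countable.mono fun x hx => ?_)
      by_contra hc
      refine hx ?_
      by_cases hxI : x ∈ Ioo a b
      · have hxT : x ∈ T := by_contra fun h' => hc ⟨hxI, h'⟩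
        simp only [indicator_of_mem hxI, innerDensity, if_pos hxT]
      · simp only [indicator_of_notMem hxI, inner_zero_left]
    refine h3.aestronglyMeasurable.congr ?_
    filter_upwards [h.inner_mem] with x hx using indicator_of_mem hx _
  · filter_upwards [h.inner_mem] with s hs
    rw [innerDensity, Real.norm_eq_abs]
    split_ifs with hsT
    · refine (abs_real_inner_le_norm _ _).trans ?_
      gcongr
      exact (hD s hsT _ (by simpa using hR s hs)).trans (le_max_left _ _)
    · have h4 := hD' s hs (rightTrace u s)
        (by simpa using norm_rightTrace_le h.boundedVariationOn h.integrableOn hR hs)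
        (leftTrace u s)
        (by simpa using norm_leftTrace_le h.boundedVariationOn h.integrableOn hR hs)
      rw [← h.inner_singleton s hs, norm_smul, Real.norm_eq_abs, abs_of_nonneg measureReal_nonneg] at h4
      rw [abs_mul, abs_inv, abs_of_nonneg measureReal_nonneg]
      rcases eq_or_ne (κ.real {s}) 0 with h0 | h0
      · rw [h0, inv_zero, zero_mul]; positivity
      · rw [inv_mul_le_iff₀ (lt_of_le_of_ne measureReal_nonneg h0.symm)]
        refine h4.trans ?_
        calc D' * (κ.real {s} * ‖θ s‖) = κ.real {s} * (D' * ‖θ s‖) := by ring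
          _ ≤ _ := by gcongr; exact le_max_right _ _

lemma setIntegral_deriv_mul_comp (h : HasDensities a b B u m κ ρ θ) (hT : IsRegularSet a b B u T)
    (hab : a < b) [IsFiniteMeasure m] [IsFiniteMeasure κ] {φ : ℝ → ℝ} (hφ : IsTestFun a b φ) :
    ∫ x in Ioo a b, deriv φ x * B x (u x) = -((∫ x, φ x * ρ x (rightTrace u x) ∂m) +
      ∫ x, φ x * innerDensity B u T κ θ x ∂κ) := by
  obtain ⟨R, hR⟩ := exists_norm_le_of_boundedVariationOn h.boundedVariationOn
  refine hφ.setIntegral_deriv_mul_of_increments hab (hT.countable.measure_zero _) m κ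
    (h.integrable_outer hT) (h.integrable_inner hT) fun x hx y hy hxy => ?_
  refine hT.comp_sub_comp h.boundedVariationOn h.integrableOn hR h.outer_continuous
    h.outer_integrable h.outer_bound (fun w x hx y hy hxy => ?_) h.inner_integrable
    (fun x hx y hy hxy => ?_) h.inner_singleton hx.2 hy.2 hxy
  · rw [h.outer_Ioc w x (hT.subset hx) y (hT.subset hy) hxy, hT.rightTrace_eq y hy,
      hT.rightTrace_eq x hx]
  · rw [h.inner_Ioc x (hT.subset hx) y (hT.subset hy) hxy,
      hT.rightTrace_eq_self h.integrableOn hy, hT.rightTrace_eq_self h.integrableOn hx]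

/-- By the integration by parts formula, the variation of the composition is at most the mass of its
two densities. -/
lemma isBV_comp (h : HasDensities a b B u m κ ρ θ) (hT : IsRegularSet a b B u T)
    (hab : a < b) [IsFiniteMeasure m] [IsFiniteMeasure κ] : IsBV a b (fun x => B x (u x)) := by
  obtain ⟨R, hR⟩ := exists_norm_le_of_boundedVariationOn h.boundedVariationOn
  constructor
  · obtain ⟨x₀, hx₀⟩ := nonempty_Ioo.2 hab
    obtain ⟨D, hD0, hD⟩ := hT.abs_sub_le (max R 0)
    obtain ⟨R', hR'⟩ := exists_norm_le_of_boundedVariationOn (hT.boundedVariationOn (0 : E))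
    have hm := measurable_indicator_of_continuousOn hT.measurableSet hT.countable hT.subset
      (hT.continuousOn_comp hR)
    have hfin : IsFiniteMeasure (volume.restrict (Ioo a b)) := ⟨by simp⟩
    refine Integrable.of_bound (C := R' + D * max R 0) (hm.aestronglyMeasurable.congr
      (indicator_ae_eq_restrict measurableSet_Ioo)) ?_
    filter_upwards [ae_restrict_Ioo_mem_of_countable hT.countable] with x hx
    have hux := (hR x (hT.subset hx)).trans (le_max_left R 0)
    have h1 := hD x hx (u x) (by rwa [mem_closedBall_zero_iff]) 0 (by simp)
    have h2 := hR' x (hT.subset hx)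
    rw [Real.norm_eq_abs] at h2 ⊢
    rw [sub_zero] at h1
    have h3 : D * ‖u x‖ ≤ D * max R 0 := by gcongr
    have h4 : |B x (u x)| ≤ |B x 0| + |B x (u x) - B x 0| := by
      have := abs_add_le (B x 0) (B x (u x) - B x 0)
      rwa [add_sub_cancel] at this
    linarith
  · refine (iSup_le fun φ => ?_ : _ ≤ ENNReal.ofReal
      ((∫ x, |ρ x (rightTrace u x)| ∂m) + ∫ x, |innerDensity B u T κ θ x| ∂κ)).trans_lt
      ENNReal.ofReal_lt_top
    obtain ⟨φ, hφ, hφ1⟩ := φ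
    refine ENNReal.ofReal_le_ofReal ?_
    have h1 := h.setIntegral_deriv_mul_comp hT hab hφ
    have h2 : ∀ (m : Measure ℝ) (k : ℝ → ℝ), Integrable k m →
        -∫ x, φ x * k x ∂m ≤ ∫ x, |k x| ∂m := by
      intro m k hk
      rw [← integral_neg]
      refine integral_mono (hφ.integrable_mul hk).neg hk.abs fun x => ?_
      refine (neg_le_abs _).trans ?_
      rw [abs_mul]
      exact mul_le_of_le_one_left (abs_nonneg _) (hφ1 x)
    have h3 := h2 m _ (h.integrable_outer hT)
    have h4 := h2 κ _ (h.integrable_inner hT)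
    calc ∫ x in Ioo a b, inner ℝ (B x (u x)) (deriv φ x) =
        ∫ x in Ioo a b, deriv φ x * B x (u x) := by simp
      _ ≤ _ := by rw [h1, neg_add]; exact add_le_add h3 h4

/-- The mass of the derivative of the composition at a point off the regular set. -/
lemma compJump_eq (h : HasDensities a b B u m κ ρ θ) {s : ℝ}
    (hs : s ∈ Ioo a b \ T) : compJump B u s =
      m.real {s} * ρ s (rightTrace u s) + κ.real {s} * innerDensity B u T κ θ s := by
  rw [h.outer_singleton _ s hs.1, innerDensity, if_neg hs.2, compJump]
  rcases eq_or_ne (κ.real {s}) 0 with h0 | h0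
  · have h1 := h.inner_singleton s hs.1
    rw [h0, zero_smul] at h1
    rw [h0, zero_mul, add_zero, sub_eq_zero.1 h1.symm]
  · rw [mul_inv_cancel_left₀ h0]
    ring

/-- The measure `ρ(·, u₊) m + L κ`, with `L` the inner density, is purely atomic on the countable
complement of the regular set, where its atoms are the jumps of the composition. -/
lemma hasSum_compJump (h : HasDensities a b B u m κ ρ θ) (hT : IsRegularSet a b B u T) {p : ℝ → ℝ}
    (hm : Integrable (fun x => p x * ρ x (rightTrace u x)) m)
    (hκ : Integrable (fun x => p x * innerDensity B u T κ θ x) κ) :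
    HasSum (fun s : ↥(Ioo a b \ T) => p s * compJump B u s)
      ((∫ x in Ioo a b \ T, p x * ρ x (rightTrace u x) ∂m) +
        ∫ x in Ioo a b \ T, p x * innerDensity B u T κ θ x ∂κ) := by
  have := hT.countable.to_subtype
  have h1 : ∀ (μ : Measure ℝ) (k : ℝ → ℝ), Integrable k μ →
      HasSum (fun s : ↥(Ioo a b \ T) => μ.real {(s : ℝ)} * k s) (∫ x in Ioo a b \ T, k x ∂μ) := by
    intro μ k hk
    have hsum := hasSum_integral_iUnion (μ := μ) (f := k)
      (s := fun s : ↥(Ioo a b \ T) => {(s : ℝ)}) (fun s => measurableSet_singleton _)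
      (fun s t hst => by simpa [Function.onFun] using fun h => hst (Subtype.ext h))
      hk.integrableOn
    rw [iUnion_of_singleton_coe] at hsum
    simpa only [integral_singleton, smul_eq_mul] using hsum
  convert! (h1 m _ hm).add (h1 κ _ hκ) using 2 with s
  rw [h.compJump_eq s.2]
  ring

/-- Integration by parts for the composition, with the diffuse part and the atoms separated. -/
lemma setIntegral_deriv_mul_comp_eq (h : HasDensities a b B u m κ ρ θ)
    (hT : IsRegularSet a b B u T) (hab : a < b) [IsFiniteMeasure m] [IsFiniteMeasure κ] {φ : ℝ → ℝ}
    (hφ : IsTestFun a b φ) :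
    ∫ x in Ioo a b, deriv φ x * B x (u x) = -(∫ x in T, φ x * ρ x (u x) ∂m) -
      (∫ x in T, φ x * inner ℝ (gradient (B x) (u x)) (θ x) ∂κ) -
        ∑' s : ↥(Ioo a b \ T), φ s * compJump B u s := by
  have h1 := hφ.integrable_mul (h.integrable_outer hT)
  have h2 := hφ.integrable_mul (h.integrable_inner hT)
  have hs : ∀ (μ : Measure ℝ) (k : ℝ → ℝ), (∀ᵐ x ∂μ, x ∈ Ioo a b) → Integrable k μ →
      ∫ x, k x ∂μ = (∫ x in T, k x ∂μ) + ∫ x in Ioo a b \ T, k x ∂μ := by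
    intro μ k hμ hk
    rw [← setIntegral_union disjoint_sdiff_right (measurableSet_Ioo.diff hT.measurableSet)
      hk.integrableOn hk.integrableOn, union_sdiff_cancel hT.subset,
      Measure.restrict_eq_self_of_ae_mem hμ]
  rw [h.setIntegral_deriv_mul_comp hT hab hφ, hs m _ h.outer_mem h1, hs κ _ h.inner_mem h2,
    (h.hasSum_compJump hT h1 h2).tsum_eq,
    setIntegral_congr_fun hT.measurableSet (f := fun x => φ x * ρ x (rightTrace u x))
      (g := fun x => φ x * ρ x (u x)) fun x hx => by
      simp only [hT.rightTrace_eq_self h.integrableOn hx],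
    setIntegral_congr_fun hT.measurableSet (f := fun x => φ x * innerDensity B u T κ θ x)
      (g := fun x => φ x * inner ℝ (gradient (B x) (u x)) (θ x)) fun x hx => by
      simp only [innerDensity, if_pos hx]]
  ring

end HasDensities

end Composition

/-! ### The chain rule -/

section ChainRule

variable {a b : ℝ}

lemma abs_sub_le_of_variation_sub_le {D D' : SignedMeasure ℝ} {μ : Measure ℝ} [IsFiniteMeasure μ]
    {c : ℝ} (hc : 0 ≤ c) {A : Set ℝ} (h : (D - D').variation A ≤ ENNReal.ofReal c * μ A) :
    |D A - D' A| ≤ c * μ.real A := by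
  have h1 := (VectorMeasure.enorm_measure_le_variation (D - D') A).trans h
  rw [sub_apply, ← ofReal_norm, ← ofReal_measureReal, ← ENNReal.ofReal_mul hc] at h1
  exact (ENNReal.ofReal_le_ofReal_iff (by positivity)).1 h1

lemma ae_eq_rnDeriv_of_eq_withDensity {m : Measure ℝ} {D : SignedMeasure ℝ} {h : ℝ → ℝ}
    (hh : Integrable h m) (hD : D = m.withDensityᵥ h) : h =ᵐ[m] D.rnDeriv m :=
  SignedMeasure.eq_rnDeriv 0 h hh VectorMeasure.MutuallySingular.zero_left (by rw [hD, zero_add])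

lemma IsGoodBV.boundedVariationOn {E : Type*} [NormedAddCommGroup E] [InnerProductSpace ℝ E]
    {u : ℝ → E} (hu : IsGoodBV a b u) : BoundedVariationOn u (Ioo a b) := by
  rw [BoundedVariationOn, hu.2]; exact hu.1.2.ne

/-- Off `N ∪ J_u`, both `u` and the section `B(·, w)` through its value `w` have no jump. -/
lemma compJump_eq_zero {E : Type*} [NormedAddCommGroup E] [NormedSpace ℝ E] {B : ℝ → E → ℝ}
    {u : ℝ → E} {N : Set ℝ} (hJ : ∀ w, jumpSet a b (fun x => B x w) ⊆ N) {s : ℝ} (hs : s ∈ Ioo a b)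
    (hsN : s ∉ N ∪ jumpSet a b u) : compJump B u s = 0 := by
  have h1 : leftTrace u s = rightTrace u s := by
    by_contra h; exact hsN (Or.inr ⟨hs, h⟩)
  rw [compJump, h1, sub_eq_zero]
  by_contra h
  exact hsN (Or.inl (hJ (rightTrace u s) ⟨hs, fun h' => h h'.symm⟩))

section Coordinates

variable {d : ℕ} {u θ : ℝ → EuclideanSpace ℝ (Fin d)} {T : Set ℝ}
  {B : ℝ → EuclideanSpace ℝ (Fin d) → ℝ}

lemma inner_eq_sum (x y : EuclideanSpace ℝ (Fin d)) : inner ℝ x y = ∑ i, x i * y i := by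
  rw [PiLp.inner_apply]
  exact Finset.sum_congr rfl fun i _ => by simp [mul_comm]

lemma IsRegularSet.aestronglyMeasurable_gradient (hT : IsRegularSet a b B u T) {m : Measure ℝ}
    (hm : ∀ᵐ x ∂m, x ∈ T) (i : Fin d) :
    AEStronglyMeasurable (fun x => gradient (B x) (u x) i) m := by
  have h1 := measurable_indicator_of_continuousOn hT.measurableSet hT.countable hT.subset
    hT.continuousOn_gradient
  refine ((EuclideanSpace.proj i : EuclideanSpace ℝ (Fin d) →L[ℝ] ℝ).continuous.measurable.comp
    h1).aestronglyMeasurable.congr ?_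
  filter_upwards [hm] with x hx
  simp [indicator_of_mem (hT.subset hx)]

lemma IsRegularSet.exists_abs_gradient_le (hT : IsRegularSet a b B u T)
    (hu : BoundedVariationOn u (Ioo a b)) :
    ∃ D, ∀ s ∈ T, ∀ i, ‖gradient (B s) (u s) i‖ ≤ D := by
  obtain ⟨R, hR⟩ := exists_norm_le_of_boundedVariationOn hu
  obtain ⟨D, _, hD⟩ := hT.bound R
  exact ⟨D, fun s hs i => (PiLp.norm_apply_le _ i).trans
    (hD s hs _ (by simpa using hR s (hT.subset hs)))⟩

/-- The diffuse part of the integral against `D_w B(·, u) · Du`, written with the absolutely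
continuous and the Cantor parts of the derivatives of the coordinates of `u`. -/
lemma IsRegularSet.setIntegral_inner_gradient (hT : IsRegularSet a b B u T) (hab : a < b)
    (hu : BoundedVariationOn u (Ioo a b)) (hui : IntegrableOn u (Ioo a b)) {lam ζ : Measure ℝ}
    [IsFiniteMeasure ζ] (hlam : IsCantorMeasure a b lam)
    (hζ : ∀ A, MeasurableSet A → (ζ A = 0 ↔ Disjoint A (Ioo a b \ T)))
    (hJ : ∀ i, jumpSet a b (fun x => u x i) ⊆ Ioo a b \ T)
    (hθ : ∀ i, Integrable (fun x => θ x i) (baseMeasure a b lam ζ))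
    (hD : ∀ i, (baseMeasure a b lam ζ).withDensityᵥ (fun x => θ x i) =
      distribDeriv a b (fun x => u x i)) {φ : ℝ → ℝ} (hφ : IsTestFun a b φ) :
    ∫ x in T, φ x * inner ℝ (gradient (B x) (u x)) (θ x) ∂baseMeasure a b lam ζ =
      (∫ x in Ioo a b, φ x * ∑ i, gradient (B x) (u x) i * nabla a b (fun y => u y i) x) +
      ∑ i, VectorMeasure.integral (cantorPart a b (fun y => u y i))
        (fun x => φ x * gradient (B x) (u x) i) (ContinuousLinearMap.lsmul ℝ ℝ) := by
  obtain ⟨D, hDb⟩ := hT.exists_abs_gradient_le hu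
  obtain ⟨C, hC⟩ := hφ.exists_bound
  have hv := ae_restrict_Ioo_mem_of_countable hT.countable
  have hl := ae_mem_of_countable hlam.diffuse hlam.carried hT.countable
  have hmeas : ∀ m : Measure ℝ, (∀ᵐ x ∂m, x ∈ T) → ∀ i,
      AEStronglyMeasurable (fun x => φ x * gradient (B x) (u x) i) m := fun m hm i =>
    hφ.contDiff.continuous.aestronglyMeasurable.mul (hT.aestronglyMeasurable_gradient hm i)
  have hbd : ∀ m : Measure ℝ, (∀ᵐ x ∂m, x ∈ T) → ∀ i,
      ∀ᵐ x ∂m, ‖φ x * gradient (B x) (u x) i‖ ≤ C * D := fun m hm i => by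
    filter_upwards [hm] with x hx
    rw [norm_mul]
    exact mul_le_mul (hC x) (hDb x hx i) (norm_nonneg _) ((norm_nonneg _).trans (hC x))
  have hθ' := fun i => (integrable_baseMeasure_iff.1 (hθ i)).1
  have hint : ∀ m : Measure ℝ, (∀ᵐ x ∂m, x ∈ T) → (∀ i, Integrable (fun x => θ x i) m) → ∀ i,
      Integrable (fun x => φ x * gradient (B x) (u x) i * θ x i) m := fun m hm hθm i =>
    (hθm i).bdd_mul (hmeas m hm i) (hbd m hm i)
  have hexp : ∀ x, φ x * inner ℝ (gradient (B x) (u x)) (θ x) =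
      ∑ i, φ x * gradient (B x) (u x) i * θ x i := fun x => by
    rw [inner_eq_sum, Finset.mul_sum]
    exact Finset.sum_congr rfl fun i _ => by ring
  have hi1 := integrable_finsetSum Finset.univ fun i _ => hint _ hv (fun i => (hθ' i).1) i
  have hi2 := integrable_finsetSum Finset.univ fun i _ => hint _ hl (fun i => (hθ' i).2) i
  rw [baseMeasure_restrict hlam hζ hT.measurableSet hT.countable disjoint_sdiff_right]
  simp_rw [hexp]
  rw [integral_add_measure hi1 hi2]
  congr 1
  · refine integral_congr_ae ?_
    have hn : ∀ᵐ x ∂volume.restrict (Ioo a b), ∀ i, θ x i = nabla a b (fun y => u y i) x :=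
      ae_all_iff.2 fun i => rnDeriv_volume_ae_eq hlam hT.countable hζ (hθ i) (hD i)
    filter_upwards [hn] with x hx
    rw [Finset.mul_sum]
    exact Finset.sum_congr rfl fun i _ => by rw [← hx i]; ring
  · rw [integral_finsetSum _ fun i _ => hint _ hl (fun i => (hθ' i).2) i]
    refine Finset.sum_congr rfl fun i _ => ?_
    rw [cantorPart_eq_withDensity hab (boundedVariationOn_coord hu i) (integrableOn_coord hui i)
      (hJ i) hlam hT.countable hζ (hθ i) (hD i),
      integral_withDensityᵥ_lsmul (hθ' i).2 (hmeas _ hl i) (hbd _ hl i)]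

end Coordinates

end ChainRule

end BVChain

set_option maxHeartbeats 800000 in
theorem theorem4p1 (d : ℕ) (a b : ℝ) (hab : a < b)
    (B : ℝ → EuclideanSpace ℝ (Fin d) → ℝ) (N : Set ℝ) (lam : Measure ℝ)
    -- `B` is locally bounded on `]a, b[ × ℝᵈ`
    (hB : ∀ K : Set (ℝ × EuclideanSpace ℝ (Fin d)), IsCompact K → K ⊆ Ioo a b ×ˢ univ →
      ∃ C : ℝ, ∀ p ∈ K, |B p.1 p.2| ≤ C)
    -- each `B(·, w)` is (a good representative of) a `BV` function, with jump set in `N`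
    (hBV : ∀ w, BVChain.IsGoodBV a b (fun x => B x w))
    (hN : N.Countable) (hNab : N ⊆ Ioo a b)
    (hJ : ∀ w, BVChain.jumpSet a b (fun x => B x w) ⊆ N)
    -- `|DₓB(·, w) - DₓB(·, w')|(A) ≤ |w - w'| μ_M(A)`
    (hLip : ∀ M : Set (EuclideanSpace ℝ (Fin d)), IsCompact M →
      ∃ μ : Measure ℝ, IsFiniteMeasure μ ∧ ∀ w ∈ M, ∀ w' ∈ M, ∀ A ⊆ Ioo a b, MeasurableSet A →
        (BVChain.distribDeriv a b (fun x => B x w)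
          - BVChain.distribDeriv a b (fun x => B x w')).variation A
          ≤ ENNReal.ofReal ‖w - w'‖ * μ A)
    -- `B(x, ·)` is `C¹` off `N`, with locally bounded gradient
    (hC1 : ∀ x ∈ Ioo a b \ N, ContDiff ℝ 1 (B x))
    (hgrad : ∀ M : Set (EuclideanSpace ℝ (Fin d)), IsCompact M →
      ∃ D : ℝ, 0 < D ∧ ∀ x ∈ Ioo a b \ N, ∀ w ∈ M, ‖gradient (B x) w‖ ≤ D)
    -- `D_w B(·, w)` is in `BV`
    (hgradBV : ∀ w, BVChain.IsBV a b (fun x => gradient (B x) w))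
    -- `Dᶜₓ B(·, w) ≪ lam` for a finite Cantor measure `lam`
    (hlam : BVChain.IsCantorMeasure a b lam)
    (hac : ∀ w, ∀ A : Set ℝ, MeasurableSet A → lam A = 0 →
      BVChain.cantorPart a b (fun x => B x w) A = 0) :
    -- the densities `∇ₓB` and `ψ` exist as functions of `(x, w)`
    (∃ g : ℝ → EuclideanSpace ℝ (Fin d) → ℝ, BVChain.IsDensityFamily (volume.restrict (Ioo a b))
      (fun w => BVChain.distribDeriv a b (fun x => B x w)) g) ∧
    (∃ ψ : ℝ → EuclideanSpace ℝ (Fin d) → ℝ, BVChain.IsDensityFamily lam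
      (fun w => BVChain.cantorPart a b (fun x => B x w)) ψ) ∧
    ∀ u : ℝ → EuclideanSpace ℝ (Fin d), BVChain.IsGoodBV a b u →
      BVChain.IsBV a b (fun x => B x (u x)) ∧
      ∀ g ψ : ℝ → EuclideanSpace ℝ (Fin d) → ℝ,
        BVChain.IsDensityFamily (volume.restrict (Ioo a b))
          (fun w => BVChain.distribDeriv a b (fun x => B x w)) g →
        BVChain.IsDensityFamily lam (fun w => BVChain.cantorPart a b (fun x => B x w)) ψ →
        -- all the terms of the formula are well defined
        IntegrableOn (fun x => g x (u x)) (Ioo a b) ∧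
        Integrable (fun x => ψ x (u x)) lam ∧
        (∀ i, IntegrableOn
          (fun x => gradient (B x) (u x) i * BVChain.nabla a b (fun y => u y i) x) (Ioo a b)) ∧
        (∀ i, Integrable (fun x => gradient (B x) (u x) i)
          (BVChain.cantorPart a b (fun y => u y i)).variation) ∧
        Summable (fun x : ↥(N ∪ BVChain.jumpSet a b u) => BVChain.compJump B u x) ∧
        -- the chain rule
        ∀ φ : ℝ → ℝ, BVChain.IsTestFun a b φ →
          ∫ x in Ioo a b, deriv φ x * B x (u x) =
            - (∫ x in Ioo a b, φ x * g x (u x))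
            - (∫ x, φ x * ψ x (u x) ∂lam)
            - (∫ x in Ioo a b,
                φ x * ∑ i, gradient (B x) (u x) i * BVChain.nabla a b (fun y => u y i) x)
            - (∑ i, VectorMeasure.integral (BVChain.cantorPart a b (fun y => u y i))
                (fun x => φ x * gradient (B x) (u x) i) (ContinuousLinearMap.lsmul ℝ ℝ))
            - ∑' x : ↥(N ∪ BVChain.jumpSet a b u), φ x * BVChain.compJump B u x := by
  have hBv : ∀ w, BoundedVariationOn (fun x => B x w) (Ioo a b) := fun w =>
    (hBV w).boundedVariationOn
  have hBi : ∀ w, IntegrableOn (fun x => B x w) (Ioo a b) := fun w => (hBV w).1.1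
  choose μ hμf hμ using fun n : ℕ =>
    hLip (Metric.closedBall 0 n) (isCompact_closedBall _ _)
  have hμ' : ∀ n : ℕ, ∀ w ∈ Metric.closedBall (0 : EuclideanSpace ℝ (Fin d)) n,
      ∀ w' ∈ Metric.closedBall (0 : EuclideanSpace ℝ (Fin d)) n, ∀ A, MeasurableSet A →
        A ⊆ Ioo a b → |BVChain.distribDeriv a b (fun x => B x w) A -
          BVChain.distribDeriv a b (fun x => B x w') A| ≤ ‖w - w'‖ * (μ n).real A :=
    fun n w hw w' hw' A hA hAI => BVChain.abs_sub_le_of_variation_sub_le (norm_nonneg _)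
      (hμ n w hw w' hw' A hAI hA)
  have hlf := hlam.finite
  obtain ⟨ζ, hζf, hζ⟩ := BVChain.exists_measure_atoms hN
  obtain ⟨ρ, hρc, hρm, hρi, hρb, hρ⟩ :=
    BVChain.exists_density_family hab hN hBv hBi hJ hμ' hlam hac hζ
  have hρg : ∀ w, (fun x => ρ x w) =ᵐ[volume.restrict (Ioo a b)]
      (BVChain.distribDeriv a b (fun x => B x w)).rnDeriv (volume.restrict (Ioo a b)) := fun w =>
    BVChain.rnDeriv_restrict_ae_eq hlam hN hζ (hρi w) (hρ w)
  have hρψ : ∀ w, (fun x => ρ x w) =ᵐ[lam]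
      (BVChain.cantorPart a b (fun x => B x w)).rnDeriv lam := fun w =>
    BVChain.ae_eq_rnDeriv_of_eq_withDensity (BVChain.integrable_baseMeasure_iff.1 (hρi w)).1.2
      (BVChain.cantorPart_eq_withDensity hab (hBv w) (hBi w) (hJ w) hlam hN hζ (hρi w) (hρ w))
  refine ⟨⟨ρ, hρg, Eventually.of_forall hρc⟩, ⟨ρ, hρψ, Eventually.of_forall hρc⟩, fun u hu => ?_⟩
  have huv := hu.boundedVariationOn
  have hui : IntegrableOn u (Ioo a b) := hu.1.1
  obtain ⟨T, hT, hTN⟩ := BVChain.exists_isRegularSet hab hN hBv hBi hC1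
    (fun R => hgrad _ (isCompact_closedBall 0 R)) hμ' huv
  have hJu : BVChain.jumpSet a b u ⊆ Ioo a b \ T := fun x hx => ⟨hx.1, fun hxT => hx.2 <| by
    rw [hT.leftTrace_eq_self hui hxT, hT.rightTrace_eq_self hui hxT]⟩
  obtain ⟨ζ', hζ'f, hζ'⟩ := BVChain.exists_measure_atoms hT.countable
  obtain ⟨lam', θ, hlam', hθm, hθi, hJi, hθD, hθI, hθs⟩ :=
    BVChain.exists_density_coord hab huv hui hT.countable hJu hζ'
  have hlf' := hlam'.finite
  have h : BVChain.HasDensities a b B u (BVChain.baseMeasure a b lam ζ)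
      (BVChain.baseMeasure a b lam' ζ') ρ θ :=
    { boundedVariationOn := huv
      integrableOn := hui
      outer_mem := BVChain.ae_mem_Ioo_baseMeasure hlam hNab hζ
      outer_continuous := hρc
      outer_integrable := hρi
      outer_measurable := hρm
      outer_bound := hρb
      outer_Ioc := fun w x hx y hy hxy => by
        rw [← (BVChain.distribDeriv_spec hab (hBv w) (hBi w)).2.1 x hx y hy hxy, ← hρ w,
          withDensityᵥ_apply (hρi w) measurableSet_Ioc]
      outer_singleton := fun w s hs => by
        rw [← (BVChain.distribDeriv_spec hab (hBv w) (hBi w)).2.2 s hs, ← hρ w,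
          withDensityᵥ_apply (hρi w) (measurableSet_singleton s), integral_singleton, smul_eq_mul]
      inner_mem := BVChain.ae_mem_Ioo_baseMeasure hlam' sdiff_subset hζ'
      inner_measurable := hθm.stronglyMeasurable
      inner_integrable := hθi
      inner_Ioc := hθI
      inner_singleton := hθs }
  refine ⟨h.isBV_comp hT hab, fun g ψ hg hψ => ?_⟩
  -- the given densities coincide with `ρ` almost everywhere, for all `w` at once
  have hgρ : ∀ᵐ x ∂volume.restrict (Ioo a b), ∀ w, g x w = ρ x w :=
    BVChain.ae_eq_of_forall_ae_eq hg.2 (Eventually.of_forall hρc) fun w =>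
      (hg.1 w).trans (hρg w).symm
  have hψρ : ∀ᵐ x ∂lam, ∀ w, ψ x w = ρ x w :=
    BVChain.ae_eq_of_forall_ae_eq hψ.2 (Eventually.of_forall hρc) fun w =>
      (hψ.1 w).trans (hρψ w).symm
  have hmT := BVChain.baseMeasure_restrict hlam hζ hT.measurableSet hT.countable hTN
  have hρu : Integrable (fun x => ρ x (u x)) (volume.restrict (Ioo a b) + lam) := by
    rw [← hmT]
    refine (h.integrable_outer hT).restrict.congr ?_
    filter_upwards [ae_restrict_mem hT.measurableSet] with x hx
    rw [hT.rightTrace_eq_self hui hx]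
  obtain ⟨hρu1, hρu2⟩ := integrable_add_measure.1 hρu
  have hv := BVChain.ae_restrict_Ioo_mem_of_countable hT.countable
  obtain ⟨D, hD⟩ := hT.exists_abs_gradient_le huv
  have hθi' : ∀ i, Integrable (fun x => θ x i) (BVChain.baseMeasure a b lam' ζ') := fun i =>
    (EuclideanSpace.proj i : EuclideanSpace ℝ (Fin d) →L[ℝ] ℝ).integrable_comp hθi
  -- sums over the irregular points are sums over `N ∪ J_u`
  have hind : ∀ p : ℝ → ℝ, (Ioo a b \ T).indicator (fun x => p x * BVChain.compJump B u x) =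
      (N ∪ BVChain.jumpSet a b u).indicator (fun x => p x * BVChain.compJump B u x) := by
    intro p
    have hsub : N ∪ BVChain.jumpSet a b u ⊆ Ioo a b \ T :=
      union_subset (fun x hx => ⟨hNab hx, fun hxT => Set.disjoint_left.1 hTN hxT hx⟩) hJu
    ext x
    by_cases hx : x ∈ N ∪ BVChain.jumpSet a b u
    · rw [indicator_of_mem hx, indicator_of_mem (hsub hx)]
    · rw [indicator_of_notMem hx]
      by_cases hx' : x ∈ Ioo a b \ T
      · rw [indicator_of_mem hx', BVChain.compJump_eq_zero hJ hx'.1 hx, mul_zero]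
      · rw [indicator_of_notMem hx']
  refine ⟨hρu1.congr ?_, hρu2.congr ?_, fun i => ?_, fun i => ?_, ?_, fun φ hφ => ?_⟩
  · filter_upwards [hgρ] with x hx using (hx _).symm
  · filter_upwards [hψρ] with x hx using (hx _).symm
  · refine (SignedMeasure.integrable_rnDeriv _ _).restrict.bdd_mul (c := D)
      (hT.aestronglyMeasurable_gradient hv i) ?_
    filter_upwards [hv] with x hx using hD x hx i
  · have hc := BVChain.isCantorMeasure_variation_cantorPart hab
      (BVChain.boundedVariationOn_coord huv i) (BVChain.integrableOn_coord hui i)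
      (hT.countable.mono (hJi i)).measurableSet
    have hcf := hc.finite
    have hcT := BVChain.ae_mem_of_countable hc.diffuse hc.carried hT.countable
    refine Integrable.of_bound (hT.aestronglyMeasurable_gradient hcT i) D ?_
    filter_upwards [hcT] with x hx using hD x hx i
  · have hsum := (h.hasSum_compJump hT (p := fun _ => 1)
      (by simpa using h.integrable_outer hT) (by simpa using h.integrable_inner hT)).summable
    have h1 := summable_subtype_iff_indicator
      (f := fun x => (fun _ => (1 : ℝ)) x * BVChain.compJump B u x).1 hsum
    rw [hind fun _ => 1] at h1
    simpa [Function.comp_def] using summable_subtype_iff_indicator.2 h1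
  · have h1 : ∫ x in T, φ x * ρ x (u x) ∂BVChain.baseMeasure a b lam ζ =
        (∫ x in Ioo a b, φ x * g x (u x)) + ∫ x, φ x * ψ x (u x) ∂lam := by
      rw [hmT, integral_add_measure (hφ.integrable_mul hρu1) (hφ.integrable_mul hρu2)]
      congr 1
      · refine integral_congr_ae ?_
        filter_upwards [hgρ] with x hx
        rw [hx]
      · refine integral_congr_ae ?_
        filter_upwards [hψρ] with x hx
        rw [hx]
    have h2 := tsum_subtype (Ioo a b \ T) fun x => φ x * BVChain.compJump B u x
    rw [hind, ← tsum_subtype] at h2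
    have h3 := h.setIntegral_deriv_mul_comp_eq hT hab hφ
    have h4 := hT.setIntegral_inner_gradient hab huv hui hlam' hζ' hJi hθi' hθD hφ
    rw [h1, h2, h4] at h3
    rw [h3]
    ring
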